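/- **Setting.** Let $a,n\in\mathbb N$ be the numbers of assets and of future times $t_1<\dots<t_n$. Fix $\underline U^j<\overline U^j$ and initial prices $S^j_{t_0}\in[\underline U^j,\overline U^j]$, $j=1,\dots,a$. For $0\le i\le n$ let $\Omega_i=[\underline U^1,\overline U^1]^i\times\dots\times[\underline U^a,\overline U^a]^i\subset\mathbb R^{ia}$ (Euclidean norm), let $\Omega=\Omega_n$ with its Borel $\sigma$-algebra, and let $S=(S^j_{t_i})$ be the coordinate process on $\Omega$. A strategy $\Delta=(\Delta_i^j)$ consists of constants $\Delta_0^j\in\mathbb R$ and functions $\Delta_i^j:\mathbb R^{ia}\to\mathbb R$, $1\le i\le n-1$; put $\Delta_{-1}=\Delta_n=0$. Let $T_i^j,L_i^j,B_i^j:\mathbb R\times\mathbb R\to\mathbb R$ ($0\le i\le n$, $1\le j\le a$) be the transaction, liquidity and borrowing cost functions. With $\Delta_i^j$ evaluated at $(S_{t_1},\dots,S_{t_i})$ set $$(\Delta\cdot S)_n=\sum_{j=1}^a\sum_{i=0}^{n-1}\Delta_i^j\,(S^j_{t_{i+1}}-S^j_{t_i}),$$ $$E_n(\Delta)=\sum_{j=1}^a\sum_{i=0}^{n}\Big[T_i^j(S^j_{t_i},\Delta_i^j-\Delta_{i-1}^j)+L_i^j(S^j_{t_i},\Delta_i^j-\Delta_{i-1}^j)+B_i^j(S^j_{t_i},\Delta_i^j)\Big],$$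 and $w_{c,\Delta}=c+(\Delta\cdot S)_n-E_n(\Delta):\Omega\to\mathbb R$ for $c\in\mathbb R$. For $B,L>0$ let $W_{B,L}$ be the set of all $w_{c,\Delta}$ (each recorded together with $c$) such that $|c|\le B$, $|\Delta_0^j|\le B$, and for $1\le i\le n-1$ every $\Delta_i^j$ is $L$-Lipschitz on $\mathbb R^{ia}$ with $\sup_{\Omega_i}|\Delta_i^j|\le B$. For an activation $\psi:\mathbb R\to\mathbb R$ let $\mathrm{Ridge}_{i,B,L}$ be the set of functions $f:\mathbb R^{ia}\to\mathbb R^a$ of the form $f(x)=\sum_{l=1}^N\alpha_l\,\psi(a_l\cdot x-b_l)$, with $N\in\mathbb N$, $\alpha_l\in\mathbb R^a$, $a_l\in\mathbb R^{ia}$, $b_l\in\mathbb R$, each component of which is $L$-Lipschitz and bounded by $B$ in absolute value on $\Omega_i$. Let $W^{\mathrm{Ridge}}_{B,L}$ be the set of elements of $W_{B,L}$ that, as functions on $\Omega$ with the same $c$, equal $w_{c,\Delta}$ for some $\Delta$ with $|\Delta_0^j|\le B$ for all $j$ and $(\Delta_i^1,\dots,\Delta_i^a)\in\mathrm{Ridge}_{i,B,L}$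 for all $1\le i\le n-1$. For a finite set $\mathcal P$ of Borel probability measures on $\Omega$, a function $\beta:\mathbb R\to\mathbb R$, $k\in\mathbb N$, $\Phi:\Omega\to\mathbb R$ and a $\sigma$-algebra $\mathcal G\subseteq\sigma(S)$ let $$\mathcal X_{B,L,k}(\Phi,\mathcal G)=\inf_{w_{c,\Delta}\in W_{B,L}}\Big\{c+k\sum_{P\in\mathcal P}\int_\Omega\beta\big(\mathbb E_P[\Phi(S)-w_{c,\Delta}(S)\mid\mathcal G]\big)\,dP\Big\},$$ and let $\mathcal X^{\mathrm{Ridge}}_{B,L,k}(\Phi,\mathcal G)$ be the same infimum over $W^{\mathrm{Ridge}}_{B,L}$. **Proposition 2.** Assume that all cost functions $T_i^j,L_i^j,B_i^j$ are continuous; that $\mathcal P$ is finite; that $\beta$ is continuous with $\beta(x)=0$ for $x\le0$ and $\beta(x)>0$ for $x>0$; and that $\psi$ is either the ReLU function $x\mapsto\max(x,0)$ or continuously differentiable and not a polynomial. Let $L>0$, $B>0$, and let $\Phi:\Omega\to\mathbb R$ be Borel measurable with $|\Phi|\le B$ on $\Omega$. Then for every $\sigma$-algebra $\mathcal G\subseteq\sigma(S)$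 and every $k\in\mathbb N$, $$\mathcal X^{\mathrm{Ridge}}_{B,L,k}(\Phi,\mathcal G)=\mathcal X_{B,L,k}(\Phi,\mathcal G).$$ -/

import Mathlib

open MeasureTheory
open scoped NNReal

noncomputable section

/-- A market with `a` assets observed at `n` future times: the price of asset `j` always lies in
`[lower j, upper j]`, and `spot j` is its known price at the initial time. -/
structure Market (a n : ℕ) where
  lower : Fin a → ℝ
  upper : Fin a → ℝ
  lower_lt_upper : ∀ j, lower j < upper j
  spot : Fin a → ℝ
  spot_mem : ∀ j, spot j ∈ Set.Icc (lower j) (upper j)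

/-- The three families of trading costs at time `t_i`, `i = 0, …, n`, for asset `j`.  The first real
argument is the price of the asset, the second one the quantity that is charged. -/
structure TradingCosts (a n : ℕ) where
  transaction : Fin (n + 1) → Fin a → ℝ → ℝ → ℝ
  liquidity : Fin (n + 1) → Fin a → ℝ → ℝ → ℝ
  borrowing : Fin (n + 1) → Fin a → ℝ → ℝ → ℝ

/-- All trading costs are (jointly) continuous functions of price and quantity. -/
def TradingCosts.IsContinuous {a n : ℕ} (C : TradingCosts a n) : Prop :=
  ∀ i j, Continuous (fun p : ℝ × ℝ => C.transaction i j p.1 p.2) ∧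
    Continuous (fun p : ℝ × ℝ => C.liquidity i j p.1 p.2) ∧
    Continuous (fun p : ℝ × ℝ => C.borrowing i j p.1 p.2)

/-- The space `ℝ^{ia}` of price histories of length `i`, with the Euclidean norm.  The coordinate
`(j, l)` is the price of asset `j` at the `l`-th future time (counted from `0`). -/
abbrev History (a i : ℕ) : Type := EuclideanSpace ℝ (Fin a × Fin i)

/-- A trading strategy: `Δ i h j` is the position in asset `j` chosen at time `t_i`,
`i = 0, …, n - 1`, after the prices `h` at the times `t_1, …, t_i` have been observed.
For `i = 0` the history space is a point, so that `Δ 0` is just a vector of constants. -/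
abbrev Strategy (a n : ℕ) : Type := (i : Fin n) → History a (i : ℕ) → Fin a → ℝ

/-- The part up to time `t_i` of a price path. -/
def pastPrices {a n : ℕ} (i : Fin n) (x : History a n) : History a (i : ℕ) :=
  WithLp.toLp 2 (fun p => x (p.1, Fin.castLE i.isLt.le p.2))

/-- The position in asset `j` held from time `t_i` on; at the final time everything is sold. -/
def holdingAfter {a n : ℕ} (Δ : Strategy a n) (x : History a n) (j : Fin a)
    (i : Fin (n + 1)) : ℝ :=
  Fin.lastCases (motive := fun _ => ℝ) 0 (fun l => Δ l (pastPrices l x) j) i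

/-- The position in asset `j` held just before time `t_i`; before the initial time it is zero. -/
def holdingBefore {a n : ℕ} (Δ : Strategy a n) (x : History a n) (j : Fin a)
    (i : Fin (n + 1)) : ℝ :=
  Fin.cases (motive := fun _ => ℝ) 0 (fun l => Δ l (pastPrices l x) j) i

namespace Market

variable {a n : ℕ} (M : Market a n)

/-- The box `Ω_i ⊆ ℝ^{ia}` of price histories of length `i`. -/
def box (i : ℕ) : Set (History a i) :=
  {x | ∀ j l, x (j, l) ∈ Set.Icc (M.lower j) (M.upper j)}

/-- The path space `Ω = Ω_n`, with its Borel σ-algebra. -/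
abbrev Path : Type := M.box n

/-- The price process `S`: the price of asset `j` at time `t_i`, `i = 0, …, n`. -/
def price (x : History a n) (j : Fin a) (i : Fin (n + 1)) : ℝ :=
  Fin.cases (motive := fun _ => ℝ) (M.spot j) (fun l => x (j, l)) i

/-- The σ-algebra `σ(S)` on the path space that is generated by the price process. -/
abbrev sigmaS : MeasurableSpace M.Path :=
  ⨆ (j : Fin a) (i : Fin (n + 1)),
    MeasurableSpace.comap (fun x : M.Path => M.price (x : History a n) j i) (borel ℝ)

/-- The gross profit `(Δ · S)_n`. -/
def gain (Δ : Strategy a n) (x : History a n) : ℝ :=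
  ∑ j, ∑ i : Fin n, Δ i (pastPrices i x) j * (M.price x j i.succ - M.price x j i.castSucc)

/-- The total cost `E_n(Δ)`: transaction and liquidity costs are charged on the quantity traded
at time `t_i`, borrowing costs on the position held from time `t_i` on. -/
def totalCost (C : TradingCosts a n) (Δ : Strategy a n) (x : History a n) : ℝ :=
  ∑ j, ∑ i : Fin (n + 1),
    (C.transaction i j (M.price x j i) (holdingAfter Δ x j i - holdingBefore Δ x j i) +
      C.liquidity i j (M.price x j i) (holdingAfter Δ x j i - holdingBefore Δ x j i) +
      C.borrowing i j (M.price x j i) (holdingAfter Δ x j i))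

/-- The function `w_{c,Δ} : Ω → ℝ`, the value of the strategy `Δ` started with the cash `c`. -/
def wealth (C : TradingCosts a n) (c : ℝ) (Δ : Strategy a n) (x : M.Path) : ℝ :=
  c + M.gain Δ (x : History a n) - M.totalCost C Δ (x : History a n)

/-- The set `W_{B,L}`.  Since the functionals below depend on `w_{c,Δ}` and on `c`, its elements are
recorded as pairs `(c, w)` of a cash amount `c` and a function `w` on `Ω` with `w = w_{c,Δ}`. -/
def W (C : TradingCosts a n) (B : ℝ) (L : ℝ≥0) : Set (ℝ × (M.Path → ℝ)) :=
  {p | |p.1| ≤ B ∧ ∃ Δ : Strategy a n, p.2 = M.wealth C p.1 Δ ∧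
    ∀ i j, LipschitzWith L (fun h => Δ i h j) ∧ ∀ h ∈ M.box i, |Δ i h j| ≤ B}

end Market

/-- The class of ridgelet networks with activation `ψ`, from a Euclidean space to `ℝ^d`: finite sums
`x ↦ ∑ l, α l * ψ (A l · x - b l)` with output weights `α l` in `ℝ^d`. -/
def Ridge (ψ : ℝ → ℝ) (ι : Type) [Fintype ι] (d : ℕ) : Set (EuclideanSpace ℝ ι → Fin d → ℝ) :=
  {f | ∃ (N : ℕ) (α : Fin N → Fin d → ℝ) (A : Fin N → EuclideanSpace ℝ ι) (b : Fin N → ℝ),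
    ∀ x, f x = ∑ l, ψ (inner ℝ (A l) x - b l) • α l}

namespace Market

variable {a n : ℕ} (M : Market a n)

/-- The class `Ridge_{i,B,L}`: ridgelet networks `ℝ^{ia} → ℝ^a` all of whose components are
`L`-Lipschitz and bounded by `B` on `Ω_i`. -/
def RidgeBL (ψ : ℝ → ℝ) (i : ℕ) (B : ℝ) (L : ℝ≥0) : Set (History a i → Fin a → ℝ) :=
  {f | f ∈ Ridge ψ (Fin a × Fin i) a ∧
    ∀ j, LipschitzOnWith L (fun h => f h j) (M.box i) ∧ ∀ h ∈ M.box i, |f h j| ≤ B}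

/-- The set of those elements `w_{c,Δ}` of `W_{B,L}` for which `Δ_i` belongs to `Ridge_{i,B,L}` for
`i = 1, …, n - 1`; the constants `Δ_0` are bounded by `B`. -/
def WRidge (ψ : ℝ → ℝ) (C : TradingCosts a n) (B : ℝ) (L : ℝ≥0) :
    Set (ℝ × (M.Path → ℝ)) :=
  {p | p ∈ M.W C B L ∧ ∃ Δ : Strategy a n, p.2 = M.wealth C p.1 Δ ∧
    (∀ i : Fin n, (i : ℕ) = 0 → ∀ h j, |Δ i h j| ≤ B) ∧
    ∀ i : Fin n, 1 ≤ (i : ℕ) → Δ i ∈ M.RidgeBL ψ i B L}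

/-- The penalized objective `c + k ∑_P ∫ β (E_P[Φ - w | 𝓖]) dP`. -/
def objective (𝓟 : Finset (Measure M.Path)) (β : ℝ → ℝ) (Φ : M.Path → ℝ) (k : ℕ)
    (𝓖 : MeasurableSpace M.Path) (p : ℝ × (M.Path → ℝ)) : ℝ :=
  p.1 + k * ∑ P ∈ 𝓟, ∫ x, β ((P[fun y => Φ y - p.2 y | 𝓖]) x) ∂P

/-- The penalized functional `X_{B,L,k}(Φ, 𝓖)`, an infimum in the extended reals. -/
def X (C : TradingCosts a n) (𝓟 : Finset (Measure M.Path)) (β : ℝ → ℝ) (B : ℝ) (L : ℝ≥0) (k : ℕ)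
    (Φ : M.Path → ℝ) (𝓖 : MeasurableSpace M.Path) : EReal :=
  ⨅ p ∈ M.W C B L, (M.objective 𝓟 β Φ k 𝓖 p : EReal)

/-- The penalized functional `X^{Ridge}_{B,L,k}(Φ, 𝓖)` over ridgelet strategies. -/
def XRidge (ψ : ℝ → ℝ) (C : TradingCosts a n) (𝓟 : Finset (Measure M.Path)) (β : ℝ → ℝ)
    (B : ℝ) (L : ℝ≥0) (k : ℕ) (Φ : M.Path → ℝ) (𝓖 : MeasurableSpace M.Path) : EReal :=
  ⨅ p ∈ M.WRidge ψ C B L, (M.objective 𝓟 β Φ k 𝓖 p : EReal)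

end Market

/-- The penalty vanishes exactly on the non-positive half-line, and is continuous and non-negative. -/
def IsPenalty (β : ℝ → ℝ) : Prop :=
  Continuous β ∧ (∀ x, x ≤ 0 → β x = 0) ∧ ∀ x, 0 < x → 0 < β x

/-- The activation function is ReLU, or continuously differentiable and not a polynomial. -/
def IsAdmissibleActivation (ψ : ℝ → ℝ) : Prop :=
  (ψ = fun x => max x 0) ∨
    (ContDiff ℝ 1 ψ ∧ ¬ ∃ q : Polynomial ℝ, ∀ x, ψ x = q.eval x)

end

/-!
The inequality `X ≤ XRidge` is inclusion.  For the converse, every element of `W` has to be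
approximated, at the same cash, by elements of `WRidge` with nearly the same objective.

The objective is continuous for uniform convergence of the wealth
(`Market.exists_pos_abs_objective_sub_le`): conditional expectations contract the supremum norm, and
the penalty is uniformly continuous on the bounded range of the conditional expectations.  The wealth
is a continuous function of the path and of the finitely many positions held along it, so that by
compactness it depends on the strategy continuously, uniformly in the path
(`Market.exists_mem_WRidge_near`).  It remains to approximate a Lipschitz function on a box uniformly
by ridge functions with the same bound and the same Lipschitz constant
(`exists_mem_ridgeSpan_lipschitz`).  After shrinking by a factor close to one, the bound and the
constant may be exceeded slightly, and the approximation is done in two steps.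

* `exists_mem_expSpan_lipschitz`: a cut-off `g` of the function is convolved with an exponential sum
  `p` that is uniformly close to a bump function on a large ball (Stone–Weierstrass).  The convolution
  is again an exponential sum, and its increments are integrals of increments of `g` against `p`;
  hence uniform closeness of `p` to the bump function suffices to control the Lipschitz constant.
* `exp_inner_mem_lipschitzClosure`: the exponential of a linear form is itself a ridge function, so
  that approximating it in the Lipschitz seminorm is a problem on the interval `[0, 1]`.  For ReLU it
  is solved by piecewise linear interpolation.  For a continuously differentiable `ψ` one integrates
  a uniform approximation of the derivative by functions `t ↦ deriv ψ (r * t - b)`.  These are total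
  by `dilateShiftClosure_eq_top`: their closed span contains the functions `t ↦ τ (r * t - b)` for
  every mollification `τ` of `deriv ψ`, hence, by Taylor expansion in `r`, the multiples
  `iteratedDeriv k τ (-b) • t ^ k` of the monomials.  If some monomial were missing, every `τ` would
  be a polynomial of degree less than `k`, and so would be the limit `deriv ψ`.
-/

/-! ### Density of dilates and translates in dimension one -/

/-- The function `t ↦ σ (r * t - b)` on the unit interval. -/
def dilateShift (σ : C(ℝ, ℝ)) (r b : ℝ) : C(unitInterval, ℝ) :=
  σ.comp ⟨fun t : unitInterval => r * (t : ℝ) - b, by fun_prop⟩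

@[simp] theorem dilateShift_apply (σ : C(ℝ, ℝ)) (r b : ℝ) (t : unitInterval) :
    dilateShift σ r b t = σ (r * t - b) := rfl

/-- The uniform closure on `[0, 1]` of the linear span of all `t ↦ σ (r * t - b)` with `r > 0`. -/
def dilateShiftClosure (σ : C(ℝ, ℝ)) : Submodule ℝ C(unitInterval, ℝ) :=
  (Submodule.span ℝ {f | ∃ r b : ℝ, 0 < r ∧ f = dilateShift σ r b}).topologicalClosure

theorem isClosed_dilateShiftClosure (σ : C(ℝ, ℝ)) :
    IsClosed (dilateShiftClosure σ : Set C(unitInterval, ℝ)) :=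
  Submodule.isClosed_topologicalClosure _

theorem dilateShift_mem_closure (σ : C(ℝ, ℝ)) {r : ℝ} (hr : 0 < r) (b : ℝ) :
    dilateShift σ r b ∈ dilateShiftClosure σ :=
  Submodule.le_topologicalClosure _ (Submodule.subset_span ⟨r, b, hr, rfl⟩)

/-- A Bochner integral of vectors of a closed subspace lies in the subspace. -/
theorem Submodule.integral_mem_of_isClosed {X α : Type*} [NormedAddCommGroup X] [NormedSpace ℝ X]
    [CompleteSpace X] [MeasurableSpace α] {μ : Measure α} (N : Submodule ℝ X)
    (hN : IsClosed (N : Set X)) {f : α → X} (hf : Integrable f μ) (hmem : ∀ s, f s ∈ N) :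
    ∫ s, f s ∂μ ∈ N := by
  have : IsClosed (N : Set X) := hN
  have h := N.mkQL.integral_comp_comm hf
  have h0 : ∀ s, N.mkQL (f s) = 0 := fun s => (Submodule.Quotient.mk_eq_zero N).2 (hmem s)
  simp only [h0, integral_zero] at h
  exact (Submodule.Quotient.mk_eq_zero N).1 h.symm

/-- Averaging `σ` over translations does not lead out of the closure: the average is a Bochner
integral of elements. -/
theorem dilateShift_mem_of_eq_integral (σ τ : C(ℝ, ℝ)) {φ : ℝ → ℝ} (hφ : Continuous φ)
    (hφc : HasCompactSupport φ) (hτ : ∀ x, τ x = ∫ s, φ s * σ (x - s)) {r : ℝ} (hr : 0 < r)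
    (b : ℝ) : dilateShift τ r b ∈ dilateShiftClosure σ := by
  have hcont : Continuous fun s : ℝ => dilateShift σ r (b + s) := by
    refine ContinuousMap.continuous_of_continuous_uncurry _ ?_
    simp only [Function.uncurry_def, dilateShift_apply]
    fun_prop
  have hint : Integrable fun s : ℝ => φ s • dilateShift σ r (b + s) :=
    (hφ.smul hcont).integrable_of_hasCompactSupport hφc.smul_right
  have heq : dilateShift τ r b = ∫ s, φ s • dilateShift σ r (b + s) := by
    ext t
    rw [ContinuousMap.integral_apply hint, dilateShift_apply, hτ]
    refine integral_congr_ae (.of_forall fun s => ?_)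
    simp [sub_sub]
  rw [heq]
  exact Submodule.integral_mem_of_isClosed _ (isClosed_dilateShiftClosure σ) hint
    fun s => Submodule.smul_mem _ _ (dilateShift_mem_closure σ hr _)

/-- The monomial `t ↦ t ^ k` on the unit interval. -/
def unitMonomial (k : ℕ) : C(unitInterval, ℝ) := ⟨fun t => (t : ℝ) ^ k, by fun_prop⟩

/-- Expanding `τ (r * t - b)` in powers of `r` recovers the monomials, weighted by the derivatives
of `τ` at `-b`, as limits for `r → 0`. -/
theorem iteratedDeriv_smul_unitMonomial_mem (τ : C(ℝ, ℝ)) (hτ : ∀ n : ℕ, ContDiff ℝ n τ)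
    (N : Submodule ℝ C(unitInterval, ℝ)) (hN : IsClosed (N : Set C(unitInterval, ℝ)))
    (hmem : ∀ r b : ℝ, 0 < r → dilateShift τ r b ∈ N) (b : ℝ) (k : ℕ) :
    iteratedDeriv k τ (-b) • unitMonomial k ∈ N := by
  induction k using Nat.strong_induction_on with
  | _ k ih =>
  obtain ⟨D, hD⟩ := exists_taylor_mean_remainder_bound (f := τ) (a := -b) (b := -b + 1) (n := k)
    (by linarith) ((hτ (k + 1)).contDiffOn)
  have hderiv : ∀ j, iteratedDerivWithin j τ (Set.Icc (-b) (-b + 1)) (-b)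
      = iteratedDeriv j τ (-b) := fun j =>
    iteratedDerivWithin_eq_iteratedDeriv (uniqueDiffOn_Icc (by linarith)) ((hτ j).contDiffAt)
      ⟨le_rfl, by linarith⟩
  simp only [taylor_within_apply, hderiv] at hD
  suffices h : (((k.factorial : ℝ)⁻¹) * iteratedDeriv k τ (-b)) • unitMonomial k ∈ N by
    have h2 := N.smul_mem (k.factorial : ℝ) h
    rwa [smul_smul, ← mul_assoc, mul_inv_cancel₀ (by positivity), one_mul] at h2
  have hD0 : 0 ≤ D := by
    have := hD (-b + 1) ⟨by linarith, le_rfl⟩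
    have h1 := (norm_nonneg _).trans this
    simpa using h1
  rw [← SetLike.mem_coe, ← hN.closure_eq, Metric.mem_closure_iff]
  intro ε hε
  obtain ⟨r, hr0, hr1, hrε⟩ : ∃ r : ℝ, 0 < r ∧ r ≤ 1 ∧ D * r < ε := by
    refine ⟨min 1 (ε / (D + 1)), by positivity, min_le_left _ _, ?_⟩
    calc D * min 1 (ε / (D + 1)) ≤ D * (ε / (D + 1)) := by gcongr; exact min_le_right _ _
      _ < (D + 1) * (ε / (D + 1)) := by gcongr; linarith
      _ = ε := by field_simp
  -- By induction the lower Taylor terms lie in `N`; removing them and dividing by `r ^ k` leaves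
  -- the `k`-th term up to an error of at most `D * r`.
  refine ⟨(r ^ k)⁻¹ • (dilateShift τ r b - ∑ j ∈ Finset.range k,
    ((j.factorial : ℝ)⁻¹ * r ^ j) • (iteratedDeriv j τ (-b) • unitMonomial j)), ?_, ?_⟩
  · exact N.smul_mem _ (N.sub_mem (hmem r b hr0) (N.sum_mem fun j hj =>
      N.smul_mem _ (ih j (Finset.mem_range.1 hj))))
  rw [dist_comm]
  refine lt_of_le_of_lt ((ContinuousMap.dist_le (by positivity)).2 fun t => ?_) hrε
  have ht0 : 0 ≤ (t : ℝ) := t.2.1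
  have ht1 : (t : ℝ) ≤ 1 := t.2.2
  have hb := hD (r * t - b) ⟨by nlinarith, by nlinarith⟩
  rw [Finset.sum_range_succ] at hb
  simp only [sub_neg_eq_add, sub_add_cancel, smul_eq_mul, Real.norm_eq_abs] at hb
  simp only [ContinuousMap.smul_apply, ContinuousMap.sub_apply, ContinuousMap.sum_apply,
    dilateShift_apply, unitMonomial, ContinuousMap.coe_mk, smul_eq_mul, Real.dist_eq]
  have hsum : ∑ j ∈ Finset.range k,
      (j.factorial : ℝ)⁻¹ * r ^ j * (iteratedDeriv j τ (-b) * (t : ℝ) ^ j)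
      = ∑ j ∈ Finset.range k, (j.factorial : ℝ)⁻¹ * (r * t) ^ j * iteratedDeriv j τ (-b) :=
    Finset.sum_congr rfl fun j _ => by rw [mul_pow]; ring
  rw [hsum]
  have hrk : 0 < r ^ k := by positivity
  have hfac : (r ^ k)⁻¹ * (τ (r * t - b) - ∑ j ∈ Finset.range k,
        (j.factorial : ℝ)⁻¹ * (r * t) ^ j * iteratedDeriv j τ (-b))
      - (k.factorial : ℝ)⁻¹ * iteratedDeriv k τ (-b) * (t : ℝ) ^ k
      = (r ^ k)⁻¹ * (τ (r * t - b) - (∑ j ∈ Finset.range k,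
        (j.factorial : ℝ)⁻¹ * (r * t) ^ j * iteratedDeriv j τ (-b)
        + (k.factorial : ℝ)⁻¹ * (r * t) ^ k * iteratedDeriv k τ (-b))) := by
    rw [mul_pow]; field_simp; ring
  rw [hfac, abs_mul, abs_of_pos (inv_pos.2 hrk), inv_mul_le_iff₀ hrk]
  calc _ ≤ D * (r * t) ^ (k + 1) := hb
    _ ≤ D * (r * 1) ^ (k + 1) := by gcongr
    _ = r ^ k * (D * r) := by ring

/-- Every real polynomial has an antiderivative whose degree is larger by at most one. -/
theorem Polynomial.exists_derivative_eq (q : Polynomial ℝ) (k : ℕ) (hq : q.degree < k) :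
    ∃ Q : Polynomial ℝ, Q.derivative = q ∧ Q.degree < (k + 1 : ℕ) := by
  refine ⟨∑ i ∈ Finset.range k, Polynomial.monomial (i + 1) (q.coeff i / (i + 1)), ?_, ?_⟩
  · rw [Polynomial.derivative_sum]
    ext m
    simp only [Polynomial.derivative_monomial, Polynomial.finsetSum_coeff,
      Polynomial.coeff_monomial, Nat.add_sub_cancel]
    rw [Finset.sum_ite_eq' (Finset.range k) m]
    split_ifs with h
    · push_cast; field_simp
    · exact (Polynomial.coeff_eq_zero_of_degree_lt (hq.trans_le
        (by exact_mod_cast (not_lt.1 (Finset.mem_range.not.1 h))))).symm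
  · refine (Polynomial.degree_sum_le _ _).trans_lt ?_
    rw [Finset.sup_lt_iff (WithBot.bot_lt_coe _)]
    intro i hi
    refine (Polynomial.degree_monomial_le _ _).trans_lt ?_
    exact_mod_cast Nat.succ_lt_succ (Finset.mem_range.1 hi)

theorem exists_polynomial_of_deriv_eq {f : ℝ → ℝ} (hf : Differentiable ℝ f) {k : ℕ}
    {q : Polynomial ℝ} (hq : q.degree < k) (h : ∀ x, deriv f x = q.eval x) :
    ∃ Q : Polynomial ℝ, Q.degree < (k + 1 : ℕ) ∧ ∀ x, f x = Q.eval x := by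
  obtain ⟨Q, hQ, hdeg⟩ := Polynomial.exists_derivative_eq q k hq
  refine ⟨Q + Polynomial.C (f 0 - Q.eval 0), ?_, fun x => ?_⟩
  · refine (Polynomial.degree_add_le _ _).trans_lt (max_lt hdeg ?_)
    exact Polynomial.degree_C_le.trans_lt (by exact_mod_cast Nat.succ_pos k)
  · have hd : Differentiable ℝ fun y => f y - Q.eval y := hf.sub Q.differentiable
    have := is_const_of_deriv_eq_zero hd (fun y => by
      rw [deriv_fun_sub (hf y) Q.differentiableAt, h, Polynomial.deriv, hQ, sub_self]) x 0
    simp only [Polynomial.eval_add, Polynomial.eval_C]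
    linarith

theorem exists_polynomial_of_iteratedDeriv_eq_zero (k : ℕ) {f : ℝ → ℝ}
    (hf : ∀ n : ℕ, ContDiff ℝ n f) (h : ∀ x, iteratedDeriv k f x = 0) :
    ∃ Q : Polynomial ℝ, Q.degree < k ∧ ∀ x, f x = Q.eval x := by
  induction k generalizing f with
  | zero => exact ⟨0, by simp, fun x => by simpa using h x⟩
  | succ k ih =>
    have hf' : ∀ n : ℕ, ContDiff ℝ n (deriv f) := fun n =>
      ((contDiff_succ_iff_deriv (n := (n : WithTop ℕ∞))).1 (by exact_mod_cast hf (n + 1))).2.2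
    obtain ⟨q, hq, he⟩ := ih hf' fun x => by rw [← iteratedDeriv_succ']; exact h x
    exact exists_polynomial_of_deriv_eq ((hf 1).differentiable (by simp)) hq he

/-- Polynomials of bounded degree are determined by finitely many values, linearly; hence a
pointwise limit of such polynomials is one of them. -/
theorem exists_polynomial_of_tendsto (k : ℕ) {f : ℝ → ℝ} {g : ℕ → ℝ → ℝ}
    (hg : ∀ m, ∃ Q : Polynomial ℝ, Q.degree < k ∧ ∀ x, g m x = Q.eval x)
    (hlim : ∀ x, Filter.Tendsto (fun m => g m x) Filter.atTop (nhds (f x))) :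
    ∃ Q : Polynomial ℝ, ∀ x, f x = Q.eval x := by
  have hinj : Set.InjOn (fun i : ℕ => (i : ℝ)) (Finset.range k : Set ℕ) :=
    Nat.cast_injective.injOn
  refine ⟨Lagrange.interpolate (Finset.range k) (fun i : ℕ => (i : ℝ)) fun i => f i, fun x => ?_⟩
  refine tendsto_nhds_unique (hlim x) ?_
  have hgm : ∀ m, g m x = ∑ i ∈ Finset.range k,
      g m i * (Lagrange.basis (Finset.range k) (fun i : ℕ => (i : ℝ)) i).eval x := by
    intro m
    obtain ⟨Q, hdeg, hQ⟩ := hg m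
    have := Lagrange.eq_interpolate (s := Finset.range k) (f := Q) hinj (by simpa using hdeg)
    rw [hQ x, this]
    simp only [Lagrange.interpolate_apply, Polynomial.eval_finsetSum, Polynomial.eval_mul,
      Polynomial.eval_C, hQ]
  simp only [hgm, Lagrange.interpolate_apply, Polynomial.eval_finsetSum, Polynomial.eval_mul,
      Polynomial.eval_C]
  exact tendsto_finsetSum _ fun i _ => (hlim i).mul_const _

/-- If the closure of the dilates and translates of `σ` misses a monomial `t ^ k`, then all
mollifications of `σ` are polynomials of degree less than `k`, and so is their limit `σ`. -/
theorem exists_polynomial_of_unitMonomial_notMem (σ : C(ℝ, ℝ)) {k : ℕ}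
    (hk : unitMonomial k ∉ dilateShiftClosure σ) : ∃ Q : Polynomial ℝ, ∀ x, σ x = Q.eval x := by
  let φ : ℕ → ContDiffBump (0 : ℝ) := fun m =>
    ⟨1 / ((m : ℝ) + 1) / 2, 1 / ((m : ℝ) + 1), by positivity, by
      have : 0 < 1 / ((m : ℝ) + 1) := by positivity
      linarith⟩
  let g : ℕ → ℝ → ℝ := fun m =>
    MeasureTheory.convolution ((φ m).normed volume) σ (ContinuousLinearMap.lsmul ℝ ℝ) volume
  have hsmooth : ∀ m, ∀ n : ℕ, ContDiff ℝ n (g m) := fun m n =>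
    ((φ m).hasCompactSupport_normed).contDiff_convolution_left _ (φ m).contDiff_normed
      σ.continuous.locallyIntegrable
  refine exists_polynomial_of_tendsto k (g := g) (fun m => ?_) fun x => ?_
  · refine exists_polynomial_of_iteratedDeriv_eq_zero k (hsmooth m) fun x => ?_
    by_contra hne
    let τ : C(ℝ, ℝ) := ⟨g m, (hsmooth m 0).continuous⟩
    have := iteratedDeriv_smul_unitMonomial_mem τ (hsmooth m) _ (isClosed_dilateShiftClosure σ)
      (fun r b hr => dilateShift_mem_of_eq_integral σ τ ((φ m).continuous_normed (μ := volume))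
        (φ m).hasCompactSupport_normed (fun x => rfl) hr b) (-x) k
    rw [neg_neg] at this
    exact hk ((Submodule.smul_mem_iff _ hne).1 this)
  · exact ContDiffBump.convolution_tendsto_right_of_continuous
      tendsto_one_div_add_atTop_nhds_zero_nat σ.continuous x

/-- A continuous function that is not a polynomial is a universal activation function in
dimension one. -/
theorem dilateShiftClosure_eq_top (σ : C(ℝ, ℝ))
    (hσ : ¬ ∃ Q : Polynomial ℝ, ∀ x, σ x = Q.eval x) : dilateShiftClosure σ = ⊤ := by
  have hmon : ∀ k, unitMonomial k ∈ dilateShiftClosure σ := fun k => by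
    by_contra h
    exact hσ (exists_polynomial_of_unitMonomial_notMem σ h)
  have hpoly : (polynomialFunctions unitInterval : Set C(unitInterval, ℝ))
      ⊆ dilateShiftClosure σ := by
    intro f hf
    obtain ⟨q, rfl⟩ := (polynomialFunctions_coe unitInterval ▸ hf :)
    have : Polynomial.toContinuousMapOnAlgHom unitInterval q
        = ∑ i ∈ Finset.range (q.natDegree + 1), q.coeff i • unitMonomial i := by
      ext t
      simp [unitMonomial, Polynomial.eval_eq_sum_range]
    rw [this]
    exact Submodule.sum_mem _ fun i _ => Submodule.smul_mem _ _ (hmon i)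
  rw [eq_top_iff]
  intro f _
  have hf : f ∈ (polynomialFunctions unitInterval).topologicalClosure := by
    rw [polynomialFunctions_closure_eq_top']; trivial
  exact closure_minimal hpoly (isClosed_dilateShiftClosure σ) hf

/-! ### Approximation by ridge functions in the Lipschitz seminorm -/

/-- The linear span of the ridge functions `x ↦ ψ (⟪A, x⟫ - b)` on an inner product space. -/
def ridgeSpan (ψ : ℝ → ℝ) (E : Type*) [NormedAddCommGroup E] [InnerProductSpace ℝ E] :
    Submodule ℝ (E → ℝ) :=
  Submodule.span ℝ {f | ∃ (A : E) (b : ℝ), f = fun x => ψ (inner ℝ A x - b)}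

/-- The closure of a space `V` of functions with respect to the seminorm that adds the supremum
and the best Lipschitz constant on `K`. -/
def lipschitzClosure {E : Type*} [SeminormedAddCommGroup E] (V : Submodule ℝ (E → ℝ))
    (K : Set E) : Submodule ℝ (E → ℝ) where
  carrier := {f | ∀ ε > 0, ∃ g ∈ V, ∀ x ∈ K, |f x - g x| ≤ ε ∧
    ∀ y ∈ K, |(f x - g x) - (f y - g y)| ≤ ε * ‖x - y‖}
  zero_mem' := fun ε hε => ⟨0, V.zero_mem, fun x _ => ⟨by simpa using hε.le, fun y _ => by
    simpa using by positivity⟩⟩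
  add_mem' := by
    intro f₁ f₂ h₁ h₂ ε hε
    obtain ⟨g₁, hg₁, H₁⟩ := h₁ (ε / 2) (by positivity)
    obtain ⟨g₂, hg₂, H₂⟩ := h₂ (ε / 2) (by positivity)
    refine ⟨g₁ + g₂, V.add_mem hg₁ hg₂, fun x hx => ⟨?_, fun y hy => ?_⟩⟩
    · have h := abs_add_le (f₁ x - g₁ x) (f₂ x - g₂ x)
      have e : (f₁ + f₂) x - (g₁ + g₂) x = (f₁ x - g₁ x) + (f₂ x - g₂ x) := by
        simp only [Pi.add_apply]; ring
      rw [e]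
      linarith [(H₁ x hx).1, (H₂ x hx).1]
    · have h := abs_add_le ((f₁ x - g₁ x) - (f₁ y - g₁ y)) ((f₂ x - g₂ x) - (f₂ y - g₂ y))
      have e : ((f₁ + f₂) x - (g₁ + g₂) x) - ((f₁ + f₂) y - (g₁ + g₂) y)
          = ((f₁ x - g₁ x) - (f₁ y - g₁ y)) + ((f₂ x - g₂ x) - (f₂ y - g₂ y)) := by
        simp only [Pi.add_apply]; ring
      rw [e]
      linarith [(H₁ x hx).2 y hy, (H₂ x hx).2 y hy]
  smul_mem' := by
    intro c f h ε hε
    obtain ⟨g, hg, H⟩ := h (ε / (|c| + 1)) (by positivity)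
    have hc : |c| * (ε / (|c| + 1)) ≤ ε := by
      rw [← mul_div_assoc, div_le_iff₀ (by positivity)]
      nlinarith [abs_nonneg c]
    refine ⟨c • g, V.smul_mem c hg, fun x hx => ⟨?_, fun y hy => ?_⟩⟩
    · simp only [Pi.smul_apply, smul_eq_mul, ← mul_sub, abs_mul]
      exact (mul_le_mul_of_nonneg_left (H x hx).1 (abs_nonneg c)).trans hc
    · simp only [Pi.smul_apply, smul_eq_mul, ← mul_sub, abs_mul]
      calc _ ≤ |c| * (ε / (|c| + 1) * ‖x - y‖) :=
            mul_le_mul_of_nonneg_left ((H x hx).2 y hy) (abs_nonneg c)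
        _ = |c| * (ε / (|c| + 1)) * ‖x - y‖ := by ring
        _ ≤ ε * ‖x - y‖ := by gcongr

theorem affine_mem_ridgeSpan_real (ψ : ℝ → ℝ) (r b : ℝ) :
    (fun t : ℝ => ψ (r * t - b)) ∈ ridgeSpan ψ ℝ :=
  Submodule.subset_span ⟨r, b, by ext t; simp [mul_comm]⟩

theorem const_mem_ridgeSpan_real {ψ : ℝ → ℝ} {b : ℝ} (hb : ψ b ≠ 0) (c : ℝ) :
    (fun _ : ℝ => c) ∈ ridgeSpan ψ ℝ := by
  have := (ridgeSpan ψ ℝ).smul_mem (c / ψ b) (affine_mem_ridgeSpan_real ψ 0 (-b))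
  convert this using 1
  ext t
  simp [hb]

/-- On `[0, 1]` it suffices to control the Lipschitz constant of the error, if the constants are
at hand. -/
theorem mem_lipschitzClosure_Icc {V : Submodule ℝ (ℝ → ℝ)} (hV : ∀ c : ℝ, (fun _ => c) ∈ V)
    {F : ℝ → ℝ} (h : ∀ ε > 0, ∃ G ∈ V, ∀ x ∈ Set.Icc (0 : ℝ) 1, ∀ y ∈ Set.Icc (0 : ℝ) 1,
      |(F x - G x) - (F y - G y)| ≤ ε * ‖x - y‖) :
    F ∈ lipschitzClosure V (Set.Icc 0 1) := by
  intro ε hε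
  obtain ⟨G, hG, H⟩ := h ε hε
  refine ⟨G + fun _ => F 0 - G 0, V.add_mem hG (hV _), fun x hx => ⟨?_, fun y hy => ?_⟩⟩
  · have h0 := H x hx 0 ⟨le_rfl, zero_le_one⟩
    have hx1 : ‖x - 0‖ ≤ 1 := by
      rw [sub_zero, Real.norm_eq_abs, abs_of_nonneg hx.1]; exact hx.2
    have e : F x - (G + (fun _ => F 0 - G 0) : ℝ → ℝ) x = (F x - G x) - (F 0 - G 0) := by
      simp only [Pi.add_apply]; ring
    rw [e]
    nlinarith
  · have e : (F x - (G + (fun _ => F 0 - G 0) : ℝ → ℝ) x)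
          - (F y - (G + (fun _ => F 0 - G 0) : ℝ → ℝ) y)
        = (F x - G x) - (F y - G y) := by
      simp only [Pi.add_apply]; ring
    rw [e]
    exact H x hx y hy

/-- For a continuously differentiable activation function, approximating the derivative uniformly
by dilates and translates of `deriv ψ` approximates the function in the Lipschitz seminorm. -/
theorem mem_lipschitzClosure_of_contDiff {ψ : ℝ → ℝ} (hψ : ContDiff ℝ 1 ψ)
    (hpoly : ¬ ∃ q : Polynomial ℝ, ∀ x, ψ x = q.eval x) {F F' : ℝ → ℝ}
    (hF : ∀ t, HasDerivAt F (F' t) t) (hF' : Continuous F') :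
    F ∈ lipschitzClosure (ridgeSpan ψ ℝ) (Set.Icc 0 1) := by
  obtain ⟨b, hb⟩ : ∃ b, ψ b ≠ 0 := by
    by_contra! h
    exact hpoly ⟨0, fun x => by simpa using h x⟩
  have hdiff : Differentiable ℝ ψ := hψ.differentiable (by simp)
  let σ : C(ℝ, ℝ) := ⟨deriv ψ, hψ.continuous_deriv le_rfl⟩
  have hσ : ¬ ∃ Q : Polynomial ℝ, ∀ x, σ x = Q.eval x := by
    rintro ⟨Q, hQ⟩
    obtain ⟨P, -, hP⟩ := exists_polynomial_of_deriv_eq hdiff (k := Q.natDegree + 1) (q := Q)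
      (Q.degree_le_natDegree.trans_lt (by exact_mod_cast Nat.lt_succ_self _)) hQ
    exact hpoly ⟨P, hP⟩
  refine mem_lipschitzClosure_Icc (const_mem_ridgeSpan_real hb) fun ε hε => ?_
  let f : C(unitInterval, ℝ) := ⟨fun t => F' t, by fun_prop⟩
  have hf : f ∈ dilateShiftClosure σ := by rw [dilateShiftClosure_eq_top σ hσ]; trivial
  obtain ⟨g, hg, hfg⟩ := Metric.mem_closure_iff.1 hf ε hε
  -- Integrating `σ (r * t - b)` gives `r⁻¹ * ψ (r * t - b)`; this needs `r ≠ 0`.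
  obtain ⟨G, hG, hGg⟩ : ∃ G ∈ ridgeSpan ψ ℝ, ∀ t : unitInterval, HasDerivAt G (g t) t := by
    refine Submodule.span_induction (p := fun g _ => ∃ G ∈ ridgeSpan ψ ℝ,
      ∀ t : unitInterval, HasDerivAt G (g t) t) ?_ ?_ ?_ ?_ hg
    · rintro _ ⟨r, b, hr, rfl⟩
      refine ⟨r⁻¹ • fun t => ψ (r * t - b),
        Submodule.smul_mem _ _ (affine_mem_ridgeSpan_real ψ r b), fun t => ?_⟩
      have h1 : HasDerivAt (fun t : ℝ => r * t - b) r (t : ℝ) := by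
        simpa using ((hasDerivAt_id (t : ℝ)).const_mul r).sub_const b
      have h2 := ((hdiff (r * t - b)).hasDerivAt.comp (t : ℝ) h1).const_smul r⁻¹
      have hv : r⁻¹ • (deriv ψ (r * t - b) * r) = dilateShift σ r b t := by
        change r⁻¹ * (deriv ψ (r * t - b) * r) = deriv ψ (r * t - b)
        field_simp
      rw [← hv]
      exact h2
    · exact ⟨0, Submodule.zero_mem _, fun t => hasDerivAt_const _ _⟩
    · rintro g₁ g₂ - - ⟨G₁, h₁, H₁⟩ ⟨G₂, h₂, H₂⟩
      exact ⟨G₁ + G₂, Submodule.add_mem _ h₁ h₂, fun t => (H₁ t).add (H₂ t)⟩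
    · rintro c g - ⟨G, h, H⟩
      exact ⟨c • G, Submodule.smul_mem _ c h, fun t => (H t).const_smul c⟩
  refine ⟨G, hG, fun x hx y hy => ?_⟩
  refine (convex_Icc (0 : ℝ) 1).norm_image_sub_le_of_norm_hasDerivWithin_le
    (f := fun t => F t - G t) (f' := fun t => F' t - deriv G t)
    (fun t ht => ?_) (fun t ht => ?_) hy hx
  · exact ((hF t).sub (hGg ⟨t, ht⟩).differentiableAt.hasDerivAt).hasDerivWithinAt
  · rw [(hGg ⟨t, ht⟩).deriv, ← dist_eq_norm]
    exact (ContinuousMap.dist_apply_le_dist (f := f) (g := g) ⟨t, ht⟩).trans hfg.le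

/-- Increments of a function along a partition add up: `max (min t (s (k + 1))) (s k)` runs through
the part of `[s k, s (k + 1)]` to the left of `t`. -/
theorem sum_clip_sub (F : ℝ → ℝ) {s : ℕ → ℝ} (hs : Monotone s) {t : ℝ} (ht : s 0 ≤ t) (N : ℕ) :
    ∑ k ∈ Finset.range N, (F (max (min t (s (k + 1))) (s k)) - F (s k))
      = F (min t (s N)) - F (s 0) := by
  induction N with
  | zero => simp [ht]
  | succ N ih =>
    rw [Finset.sum_range_succ, ih]
    have hN := hs N.le_succ
    rcases le_total t (s N) with h | h
    · rw [min_eq_left h, min_eq_left (h.trans hN), max_eq_right h]; ring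
    · rw [min_eq_right h, max_eq_left (le_min h hN)]; ring

theorem clip_eq_max_sub_max {u v : ℝ} (huv : u ≤ v) (t : ℝ) :
    max (min t v) u = u + (max (t - u) 0 - max (t - v) 0) := by
  rcases le_total t u with h | h
  · rw [min_eq_left (h.trans huv), max_eq_right h, max_eq_right (by linarith),
      max_eq_right (by linarith)]; ring
  · rcases le_total t v with h' | h'
    · rw [min_eq_left h', max_eq_left h, max_eq_left (by linarith), max_eq_right (by linarith)]
      ring
    · rw [min_eq_right h', max_eq_left huv, max_eq_left (by linarith), max_eq_left (by linarith)]
      ring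

/-- For ReLU, the piecewise linear function with slopes `F' (s k)` on the intervals
`[s k, s (k + 1)]` of a fine partition approximates `F` in the Lipschitz seminorm. -/
theorem mem_lipschitzClosure_relu {F F' : ℝ → ℝ} (hF : ∀ t, HasDerivAt F (F' t) t)
    (hF' : Continuous F') :
    F ∈ lipschitzClosure (ridgeSpan (fun x => max x 0) ℝ) (Set.Icc 0 1) := by
  set V := ridgeSpan (fun x => max x 0) ℝ with hVdef
  have hrelu : ∀ c : ℝ, (fun t : ℝ => max (t - c) 0) ∈ V := fun c => by
    simpa using affine_mem_ridgeSpan_real (fun x => max x 0) 1 c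
  refine mem_lipschitzClosure_Icc (const_mem_ridgeSpan_real (b := 1) (by simp)) fun ε hε => ?_
  have huc : UniformContinuousOn F' (Set.Icc 0 1) :=
    isCompact_Icc.uniformContinuousOn_of_continuous hF'.continuousOn
  obtain ⟨δ, hδ, hFδ⟩ := Metric.uniformContinuousOn_iff_le.1 huc ε hε
  obtain ⟨N, hN⟩ := exists_nat_one_div_lt hδ
  set s : ℕ → ℝ := fun k => k / ((N : ℝ) + 1) with hsdef
  have hN0 : (0 : ℝ) < N + 1 := by positivity
  have hs : Monotone s := fun k l hkl => by
    simp only [hsdef]; gcongr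
  have hs0 : s 0 = 0 := by simp [hsdef]
  have hs1 : s (N + 1) = 1 := by simp only [hsdef]; push_cast; exact div_self hN0.ne'
  have hstep : ∀ k, s (k + 1) - s k ≤ δ := fun k => by
    have : s (k + 1) - s k = 1 / ((N : ℝ) + 1) := by simp only [hsdef]; push_cast; ring
    rw [this]; exact hN.le
  let c : ℕ → ℝ → ℝ := fun k t => max (min t (s (k + 1))) (s k)
  have hcmem : ∀ k t, c k t ∈ Set.Icc (s k) (s (k + 1)) := fun k t =>
    ⟨le_max_right _ _, max_le (min_le_right _ _) (hs k.le_succ)⟩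
  have hcmono : ∀ k, Monotone (c k) := fun k x y hxy =>
    max_le_max (min_le_min hxy le_rfl) le_rfl
  refine ⟨∑ k ∈ Finset.range (N + 1), F' (s k) •
    ((fun t => max (t - s k) 0) - fun t => max (t - s (k + 1)) 0),
    V.sum_mem fun k _ => V.smul_mem _ (V.sub_mem (hrelu _) (hrelu _)), ?_⟩
  set G := ∑ k ∈ Finset.range (N + 1), F' (s k) •
    ((fun t : ℝ => max (t - s k) 0) - fun t => max (t - s (k + 1)) 0) with hG
  have hGt : ∀ t, G t = ∑ k ∈ Finset.range (N + 1), F' (s k) * (c k t - s k) := fun t => by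
    simp only [hG, Finset.sum_apply, Pi.smul_apply, Pi.sub_apply, smul_eq_mul]
    refine Finset.sum_congr rfl fun k _ => ?_
    simp only [c, clip_eq_max_sub_max (hs k.le_succ), add_sub_cancel_left]
  have hid : ∀ t ∈ Set.Icc (0 : ℝ) 1, ∀ H : ℝ → ℝ,
      ∑ k ∈ Finset.range (N + 1), (H (c k t) - H (s k)) = H t - H 0 := fun t ht H => by
    have := sum_clip_sub H hs (t := t) (by rw [hs0]; exact ht.1) (N + 1)
    rwa [hs1, min_eq_left ht.2, hs0] at this
  -- On each partition interval the error has derivative `F' - F' (s k)`, which is at most `ε`.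
  have hpiece : ∀ k < N + 1, ∀ x y, |(F (c k x) - F' (s k) * c k x) -
      (F (c k y) - F' (s k) * c k y)| ≤ ε * |c k x - c k y| := by
    intro k hk x y
    refine (convex_Icc (s k) (s (k + 1))).norm_image_sub_le_of_norm_hasDerivWithin_le
      (f := fun t => F t - F' (s k) * t) (f' := fun t => F' t - F' (s k))
      (fun t ht => ?_) (fun t ht => ?_) (hcmem k y) (hcmem k x)
    · have h := (hF t).fun_sub ((hasDerivAt_id' t).const_mul (F' (s k)))
      rw [mul_one] at h
      exact h.hasDerivWithinAt
    · have h0 : 0 ≤ s k := hs0 ▸ hs (Nat.zero_le k)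
      have h1 : s (k + 1) ≤ 1 := hs1 ▸ hs hk
      rw [← dist_eq_norm]
      refine hFδ t ⟨h0.trans ht.1, ht.2.trans h1⟩ (s k) ⟨h0, (hs k.le_succ).trans h1⟩ ?_
      rw [Real.dist_eq, abs_of_nonneg (by linarith [ht.1])]
      linarith [ht.2, hstep k]
  have hmain : ∀ x ∈ Set.Icc (0 : ℝ) 1, ∀ y ∈ Set.Icc (0 : ℝ) 1, y ≤ x →
      |(F x - G x) - (F y - G y)| ≤ ε * |x - y| := by
    intro x hx y hy hyx
    have e : (F x - G x) - (F y - G y) = ∑ k ∈ Finset.range (N + 1),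
        ((F (c k x) - F' (s k) * c k x) - (F (c k y) - F' (s k) * c k y)) := by
      have hx' := hid x hx F
      have hy' := hid y hy F
      have e' : (F x - G x) - (F y - G y)
          = ((F x - F 0) - G x) - ((F y - F 0) - G y) := by ring
      rw [e', hGt, hGt, ← hx', ← hy', ← Finset.sum_sub_distrib, ← Finset.sum_sub_distrib,
        ← Finset.sum_sub_distrib]
      exact Finset.sum_congr rfl fun k _ => by ring
    rw [e]
    calc _ ≤ ∑ k ∈ Finset.range (N + 1), |(F (c k x) - F' (s k) * c k x) -
          (F (c k y) - F' (s k) * c k y)| := Finset.abs_sum_le_sum_abs _ _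
      _ ≤ ∑ k ∈ Finset.range (N + 1), ε * ((c k x - s k) - (c k y - s k)) := by
          refine Finset.sum_le_sum fun k hk => (hpiece k (Finset.mem_range.1 hk) x y).trans_eq ?_
          rw [abs_of_nonneg (sub_nonneg.2 (hcmono k hyx))]; ring
      _ = ε * |x - y| := by
          have hx' := hid x hx id
          have hy' := hid y hy id
          simp only [id] at hx' hy'
          rw [← Finset.mul_sum, Finset.sum_sub_distrib, hx', hy', abs_of_nonneg (by linarith)]
          ring
  intro x hx y hy
  rcases le_total y x with h | h
  · exact hmain x hx y hy h
  · rw [abs_sub_comm, norm_sub_rev]; exact hmain y hy x hx h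

theorem mem_lipschitzClosure_of_isAdmissibleActivation {ψ : ℝ → ℝ}
    (hψ : IsAdmissibleActivation ψ) {F F' : ℝ → ℝ} (hF : ∀ t, HasDerivAt F (F' t) t)
    (hF' : Continuous F') : F ∈ lipschitzClosure (ridgeSpan ψ ℝ) (Set.Icc 0 1) := by
  rcases hψ with rfl | ⟨h1, h2⟩
  · exact mem_lipschitzClosure_relu hF hF'
  · exact mem_lipschitzClosure_of_contDiff h1 h2 hF hF'

/-- Real exponentials of linear forms belong to the Lipschitz closure of the ridge functions on
every bounded set: rescale the linear form to take values in `[0, 1]`. -/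
theorem exp_inner_mem_lipschitzClosure {ψ : ℝ → ℝ} (hψ : IsAdmissibleActivation ψ)
    {E : Type*} [NormedAddCommGroup E] [InnerProductSpace ℝ E] {K : Set E}
    (hK : Bornology.IsBounded K) (A : E) :
    (fun x => Real.exp (inner ℝ A x)) ∈ lipschitzClosure (ridgeSpan ψ E) K := by
  obtain ⟨R, hR, hKR⟩ : ∃ R > 0, ∀ x ∈ K, |inner ℝ A x| ≤ R := by
    obtain ⟨r, hr⟩ := hK.exists_norm_le
    refine ⟨‖A‖ * |r| + 1, by positivity, fun x hx => ?_⟩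
    have := abs_real_inner_le_norm A x
    have h2 : ‖A‖ * ‖x‖ ≤ ‖A‖ * |r| := by
      gcongr; exact (hr x hx).trans (le_abs_self r)
    linarith
  let u : E → ℝ := fun x => (inner ℝ A x + R) / (2 * R)
  have hu : ∀ x ∈ K, u x ∈ Set.Icc (0 : ℝ) 1 := fun x hx => by
    have := abs_le.1 (hKR x hx)
    refine ⟨div_nonneg (by linarith) (by linarith), ?_⟩
    rw [div_le_one (by linarith)]; linarith
  have hul : ∀ x y, ‖u x - u y‖ ≤ ‖A‖ / (2 * R) * ‖x - y‖ := fun x y => by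
    have : u x - u y = inner ℝ A (x - y) / (2 * R) := by
      simp only [u, inner_sub_right]; ring
    rw [this, norm_div, Real.norm_of_nonneg (by positivity : 0 ≤ 2 * R), div_mul_eq_mul_div]
    gcongr
    exact norm_inner_le_norm A (x - y)
  have hF : ∀ t, HasDerivAt (fun t => Real.exp (2 * R * t - R))
      (Real.exp (2 * R * t - R) * (2 * R)) t := fun t => by
    have h1 : HasDerivAt (fun t : ℝ => 2 * R * t - R) (2 * R) t := by
      simpa using ((hasDerivAt_id t).const_mul (2 * R)).sub_const R
    exact h1.exp
  have hmem := mem_lipschitzClosure_of_isAdmissibleActivation hψ hF (by fun_prop)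
  have hcomp : ∀ G ∈ ridgeSpan ψ ℝ, G ∘ u ∈ ridgeSpan ψ E := by
    intro G hG
    -- Affine reparametrizations of neurons are neurons.
    have hle : ridgeSpan ψ ℝ ≤ (ridgeSpan ψ E).comap (LinearMap.funLeft ℝ ℝ u) := by
      refine Submodule.span_le.2 ?_
      rintro _ ⟨r, b, rfl⟩
      refine Submodule.subset_span ⟨(r / (2 * R)) • A, b - r / 2, ?_⟩
      ext x
      simp only [LinearMap.funLeft_apply, u, inner_smul_left, RCLike.inner_apply]
      congr 1
      simp only [conj_trivial]
      field_simp
      ring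
    exact hle hG
  have hFu : ∀ x, Real.exp (2 * R * u x - R) = Real.exp (inner ℝ A x) := fun x => by
    congr 1; simp only [u]; field_simp; ring
  intro ε hε
  set q := ‖A‖ / (2 * R) with hq
  have hq0 : 0 ≤ q := by positivity
  obtain ⟨G, hG, H⟩ := hmem (ε / (q + 1)) (by positivity)
  have hle : ε / (q + 1) ≤ ε := div_le_self hε.le (by linarith)
  refine ⟨G ∘ u, hcomp G hG, fun x hx => ⟨?_, fun y hy => ?_⟩⟩
  · have := (H (u x) (hu x hx)).1
    simp only [hFu] at this
    exact this.trans hle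
  · have := (H (u x) (hu x hx)).2 (u y) (hu y hy)
    simp only [hFu] at this
    refine this.trans ?_
    calc ε / (q + 1) * ‖u x - u y‖ ≤ ε / (q + 1) * (q * ‖x - y‖) := by gcongr; exact hul x y
      _ = ε * (q / (q + 1)) * ‖x - y‖ := by ring
      _ ≤ ε * 1 * ‖x - y‖ := by
          gcongr
          rw [div_le_one (by positivity)]; linarith
      _ = ε * ‖x - y‖ := by ring

/-! ### Approximation of Lipschitz functions by exponential sums and ridge functions -/

/-- The linear span of the functions `x ↦ exp ⟪A, x⟫`. -/
def expSpan (E : Type*) [NormedAddCommGroup E] [InnerProductSpace ℝ E] : Submodule ℝ (E → ℝ) :=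
  Submodule.span ℝ {f | ∃ A : E, f = fun x => Real.exp (inner ℝ A x)}

/-- A Lipschitz function can be cut off outside a ball: truncate it at the height of a cone. -/
theorem exists_lipschitz_compactSupport_eqOn {E : Type*} [NormedAddCommGroup E]
    [ProperSpace E] {f : E → ℝ} {L : ℝ≥0} (hf : LipschitzWith L f) (R : ℝ) :
    ∃ (g : E → ℝ) (L' : ℝ≥0), LipschitzWith L' g ∧ HasCompactSupport g ∧
      ∀ x, ‖x‖ ≤ R → g x = f x := by
  obtain ⟨D, hD⟩ := (isCompact_closedBall (0 : E) R).exists_bound_of_continuousOn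
    hf.continuous.continuousOn
  let D' : ℝ≥0 := D.toNNReal
  let m : E → ℝ := fun x => max (D' * (R + 1 - ‖x‖)) 0
  have hm : LipschitzWith D' m := by
    refine LipschitzWith.max_const (LipschitzWith.of_dist_le_mul fun x y => ?_) 0
    rw [Real.dist_eq, ← mul_sub, abs_mul, abs_of_nonneg D'.coe_nonneg, dist_eq_norm]
    gcongr
    rw [show R + 1 - ‖x‖ - (R + 1 - ‖y‖) = ‖y‖ - ‖x‖ by ring, ← norm_sub_rev y x]
    exact abs_norm_sub_norm_le y x
  refine ⟨fun x => max (min (f x) (m x)) (-m x), _, (hf.min hm).max hm.neg, ?_, fun x hx => ?_⟩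
  · refine HasCompactSupport.of_support_subset_isCompact (isCompact_closedBall (0 : E) (R + 1)) ?_
    intro x hx
    by_contra hxR
    rw [mem_closedBall_zero_iff, not_le] at hxR
    have : m x = 0 := max_eq_right (mul_nonpos_of_nonneg_of_nonpos D'.coe_nonneg (by linarith))
    simp [this] at hx
  · have h1 : |f x| ≤ m x := by
      refine (hD x (mem_closedBall_zero_iff.2 hx)).trans ((Real.le_coe_toNNReal D).trans ?_)
      refine le_max_of_le_left (le_mul_of_one_le_right D'.coe_nonneg (by linarith))
    simp only
    rw [min_eq_left (abs_le.1 h1).2, max_eq_left (abs_le.1 h1).1]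

section ExpSpan

variable {E : Type*} [NormedAddCommGroup E] [InnerProductSpace ℝ E]

theorem continuous_of_mem_expSpan {p : E → ℝ} (hp : p ∈ expSpan E) : Continuous p := by
  refine Submodule.span_induction (p := fun p _ => Continuous p) ?_ continuous_zero
    (fun _ _ _ _ h₁ h₂ => h₁.add h₂) (fun c _ _ h => h.const_smul c) hp
  rintro _ ⟨A, rfl⟩
  fun_prop

/-- Stone–Weierstrass: exponentials of linear forms are closed under multiplication. -/
theorem exists_mem_expSpan_near {K : Set E} (hK : IsCompact K) {f : E → ℝ} (hf : Continuous f)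
    {ε : ℝ} (hε : 0 < ε) : ∃ p ∈ expSpan E, ∀ x ∈ K, |f x - p x| ≤ ε := by
  have : CompactSpace K := isCompact_iff_compactSpace.1 hK
  let e : E → C(K, ℝ) := fun A => ⟨fun x => Real.exp (inner ℝ A (x : E)), by fun_prop⟩
  have hclosure : (Submonoid.closure (Set.range e) : Set C(K, ℝ)) ⊆ Set.range e := by
    intro g hg
    induction hg using Submonoid.closure_induction with
    | mem g hg => exact hg
    | one => exact ⟨0, by ext x; simp [e]⟩
    | mul g₁ g₂ _ _ h₁ h₂ =>
      obtain ⟨A₁, rfl⟩ := h₁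
      obtain ⟨A₂, rfl⟩ := h₂
      exact ⟨A₁ + A₂, by ext x; simp [e, inner_add_left, Real.exp_add]⟩
  have hspan := Algebra.adjoin_eq_span_of_subset (R := ℝ) (hclosure.trans Submodule.subset_span)
  have hsep : (Algebra.adjoin ℝ (Set.range e)).SeparatesPoints := by
    intro x y hxy
    refine ⟨e ((x : E) - y), ⟨_, Algebra.subset_adjoin ⟨_, rfl⟩, rfl⟩, fun h => ?_⟩
    have h1 : inner ℝ ((x : E) - y) (x : E) = inner ℝ ((x : E) - y) (y : E) := Real.exp_injective h
    rw [← sub_eq_zero, ← inner_sub_right, inner_self_eq_zero, sub_eq_zero] at h1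
    exact hxy (Subtype.ext h1)
  obtain ⟨⟨g, hg⟩, hgf⟩ :=
    ContinuousMap.exists_mem_subalgebra_near_continuous_of_separatesPoints _ hsep
      (fun x : K => f x) (by fun_prop) ε hε
  rw [← Subalgebra.mem_toSubmodule, hspan] at hg
  obtain ⟨p, hp, hpg⟩ : ∃ p ∈ expSpan E, ∀ x : K, g x = p x := by
    refine Submodule.span_induction (p := fun g _ => ∃ p ∈ expSpan E, ∀ x : K, g x = p x)
      ?_ ?_ ?_ ?_ hg
    · rintro _ ⟨A, rfl⟩
      exact ⟨_, Submodule.subset_span ⟨A, rfl⟩, fun x => rfl⟩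
    · exact ⟨0, Submodule.zero_mem _, fun x => rfl⟩
    · rintro g₁ g₂ - - ⟨p₁, h₁, H₁⟩ ⟨p₂, h₂, H₂⟩
      exact ⟨p₁ + p₂, Submodule.add_mem _ h₁ h₂, fun x => by simp [H₁ x, H₂ x]⟩
    · rintro c g - ⟨p, h, H⟩
      exact ⟨c • p, Submodule.smul_mem _ c h, fun x => by simp [H x]⟩
  refine ⟨p, hp, fun x hx => ?_⟩
  have := (hgf ⟨x, hx⟩).le
  rw [Real.norm_eq_abs, abs_sub_comm] at this
  simpa [hpg] using this

variable [FiniteDimensional ℝ E] [MeasurableSpace E] [BorelSpace E]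

theorem integrable_comp_sub_left_mul {g q : E → ℝ} (hg : Continuous g) (hgc : HasCompactSupport g)
    (hq : Continuous q) (x : E) : Integrable fun s => g (x - s) * q s := by
  refine Continuous.integrable_of_hasCompactSupport (by fun_prop) ?_
  exact (hgc.comp_homeomorph (Homeomorph.subLeft x)).mul_right

/-- Convolution with a compactly supported function acts diagonally on exponentials. -/
theorem integral_comp_sub_mul_mem_expSpan {g : E → ℝ} (hg : Continuous g)
    (hgc : HasCompactSupport g) {p : E → ℝ} (hp : p ∈ expSpan E) :
    (fun x => ∫ s, g (x - s) * p s) ∈ expSpan E := by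
  refine Submodule.span_induction
    (p := fun p _ => (fun x => ∫ s, g (x - s) * p s) ∈ expSpan E) ?_ ?_ ?_ ?_ hp
  · rintro _ ⟨A, rfl⟩
    have : (fun x => ∫ s, g (x - s) * Real.exp (inner ℝ A s))
        = (∫ t, g t * Real.exp (-inner ℝ A t)) • fun x => Real.exp (inner ℝ A x) := by
      ext x
      rw [← integral_sub_left_eq_self _ _ x, Pi.smul_apply, smul_eq_mul, ← integral_mul_const]
      refine integral_congr_ae (.of_forall fun t => ?_)
      simp only [sub_sub_cancel]
      rw [inner_sub_right, sub_eq_add_neg, Real.exp_add]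
      ring
    rw [this]
    exact Submodule.smul_mem _ _ (Submodule.subset_span ⟨A, rfl⟩)
  · simp only [Pi.zero_apply, mul_zero, integral_zero]
    exact (expSpan E).zero_mem
  · intro p q hp hq h₁ h₂
    convert Submodule.add_mem _ h₁ h₂ using 1
    ext x
    simp only [Pi.add_apply, mul_add]
    exact integral_add (integrable_comp_sub_left_mul hg hgc (continuous_of_mem_expSpan hp) x)
      (integrable_comp_sub_left_mul hg hgc (continuous_of_mem_expSpan hq) x)
  · intro c p hp h
    convert Submodule.smul_mem _ c h using 1
    ext x
    simp only [Pi.smul_apply, smul_eq_mul, ← integral_const_mul]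
    exact integral_congr_ae (.of_forall fun s => by ring)

theorem abs_integral_le_of_le_of_eq_zero {h : E → ℝ} {c ρ : ℝ} (hb : ∀ s, ‖s‖ ≤ ρ → |h s| ≤ c)
    (h0 : ∀ s, ρ < ‖s‖ → h s = 0) :
    |∫ s, h s| ≤ c * volume.real (Metric.closedBall (0 : E) ρ) := by
  rw [← setIntegral_eq_integral_of_forall_compl_eq_zero (s := Metric.closedBall (0 : E) ρ)
    fun s hs => h0 s (by simpa using hs)]
  exact norm_setIntegral_le_of_norm_le_const (f := h) measure_closedBall_lt_top
    fun s hs => hb s (mem_closedBall_zero_iff.1 hs)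

/-- A Lipschitz function is approximated uniformly on a bounded set by exponential sums whose
Lipschitz constants there are hardly larger.  Convolve a cut-off of the function with an exponential
sum `p` that is uniformly close to a bump function `φ`.  Since the increments of the cut-off are
controlled, uniform closeness of `p` to `φ` controls the Lipschitz constant of the convolution. -/
theorem exists_mem_expSpan_lipschitz {f : E → ℝ} {L : ℝ≥0} (hf : LipschitzWith L f) {K : Set E}
    (hK : Bornology.IsBounded K) {ε : ℝ} (hε : 0 < ε) :
    ∃ e ∈ expSpan E, ∀ x ∈ K, |f x - e x| ≤ ε ∧
      ∀ y ∈ K, |e x - e y| ≤ (L + ε) * ‖x - y‖ := by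
  obtain ⟨R, hR⟩ := hK.exists_norm_le
  obtain ⟨g, L', hg, hgc, hgf⟩ := exists_lipschitz_compactSupport_eqOn hf (R + 1)
  obtain ⟨D, hD⟩ := hgc.exists_bound_of_continuous hg.continuous
  obtain ⟨R₂, hR₂⟩ := hgc.isCompact.isBounded.exists_norm_le
  have hD0 : 0 ≤ D := (norm_nonneg _).trans (hD 0)
  have hL' : ∀ x y, |g x - g y| ≤ L' * ‖x - y‖ := fun x y => by
    simpa [Real.dist_eq, dist_eq_norm] using hg.dist_le_mul x y
  have hL : ∀ x y, |f x - f y| ≤ L * ‖x - y‖ := fun x y => by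
    simpa [Real.dist_eq, dist_eq_norm] using hf.dist_le_mul x y
  let δ : ℝ := min 1 (ε / (2 * (L + 1)))
  have hδ : 0 < δ := by positivity
  have hδ1 : δ ≤ 1 := min_le_left _ _
  have hLδ : L * δ ≤ ε / 2 := by
    calc (L : ℝ) * δ ≤ (L + 1) * (ε / (2 * (L + 1))) := by
          gcongr
          · linarith
          · exact min_le_right _ _
      _ = ε / 2 := by field_simp
  let φ' : ContDiffBump (0 : E) := ⟨δ / 2, δ, by positivity, by linarith⟩
  let φ : E → ℝ := φ'.normed volume
  have hφ : Continuous φ := φ'.continuous_normed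
  have hφ0 : ∀ s, 0 ≤ φ s := φ'.nonneg_normed
  have hφ1 : ∫ s, φ s = 1 := φ'.integral_normed
  have hφi : Integrable φ := φ'.integrable_normed
  have hφs : ∀ s, φ s ≠ 0 → ‖s‖ ≤ δ := fun s hs => by
    have : s ∈ Function.support (φ'.normed volume) := hs
    rw [φ'.support_normed_eq] at this
    exact (mem_ball_zero_iff.1 this).le
  set ρ : ℝ := R + R₂ + 1 with hρ
  set v : ℝ := volume.real (Metric.closedBall (0 : E) ρ) with hv
  have hv0 : 0 ≤ v := measureReal_nonneg
  -- Outside the ball of radius `ρ` the integrands vanish, whatever `p` does there.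
  have hg0 : ∀ x ∈ K, ∀ s, ρ < ‖s‖ → g (x - s) = 0 := fun x hx s hs => by
    by_contra h
    have h1 := hR₂ (x - s) (subset_tsupport g h)
    have h2 := norm_sub_norm_le s x
    rw [norm_sub_rev] at h2
    linarith [hR x hx]
  obtain ⟨η, hη, hη1, hη2⟩ : ∃ η > 0, D * η * v ≤ ε / 2 ∧ L' * η * v ≤ ε := by
    refine ⟨ε / (2 * (D + L' + 1) * (v + 1)), by positivity, ?_, ?_⟩
    · rw [mul_div_assoc', div_mul_eq_mul_div, div_le_iff₀ (by positivity)]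
      have h1 : D * v ≤ (D + L' + 1) * (v + 1) := by
        gcongr
        · linarith [L'.coe_nonneg]
        · linarith
      nlinarith
    · rw [mul_div_assoc', div_mul_eq_mul_div, div_le_iff₀ (by positivity)]
      have h1 : L' * v ≤ (D + L' + 1) * (v + 1) := by
        gcongr
        · linarith
        · linarith
      have h2 : 0 ≤ (L' : ℝ) * v := by positivity
      nlinarith
  obtain ⟨p, hp, hpφ⟩ := exists_mem_expSpan_near (isCompact_closedBall (0 : E) ρ) hφ hη
  have hpc := continuous_of_mem_expSpan hp
  have hgφ := fun x => integrable_comp_sub_left_mul hg.continuous hgc hφ x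
  have hgp := fun x => integrable_comp_sub_left_mul hg.continuous hgc hpc x
  have hloc : ∀ x ∈ K, ∀ s, φ s ≠ 0 → g (x - s) = f (x - s) := fun x hx s hs =>
    hgf _ ((norm_sub_le x s).trans (add_le_add (hR x hx) ((hφs s hs).trans hδ1)))
  refine ⟨_, integral_comp_sub_mul_mem_expSpan hg.continuous hgc hp, fun x hx => ⟨?_, ?_⟩⟩
  · have e : f x - ∫ s, g (x - s) * p s
        = (∫ s, (f x * φ s - g (x - s) * φ s)) + ∫ s, (g (x - s) * φ s - g (x - s) * p s) := by
      rw [integral_sub (hφi.const_mul _) (hgφ x), integral_sub (hgφ x) (hgp x),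
        integral_const_mul, hφ1]
      ring
    have h1 : |∫ s, (f x * φ s - g (x - s) * φ s)| ≤ L * δ := by
      have : ‖∫ s, (f x * φ s - g (x - s) * φ s)‖ ≤ ∫ s, L * δ * φ s := by
        refine norm_integral_le_of_norm_le (hφi.const_mul _) (.of_forall fun s => ?_)
        by_cases hs : φ s = 0
        · simp [hs]
        rw [hloc x hx s hs, ← sub_mul, norm_mul, Real.norm_of_nonneg (hφ0 s)]
        refine mul_le_mul_of_nonneg_right ((hL x (x - s)).trans ?_) (hφ0 s)
        rw [sub_sub_cancel]
        exact mul_le_mul_of_nonneg_left (hφs s hs) L.coe_nonneg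
      rwa [integral_const_mul, hφ1, mul_one] at this
    have h2 : |∫ s, (g (x - s) * φ s - g (x - s) * p s)| ≤ D * η * v := by
      refine abs_integral_le_of_le_of_eq_zero (fun s hs => ?_) fun s hs => by simp [hg0 x hx s hs]
      rw [← mul_sub, abs_mul]
      exact mul_le_mul (hD _) (hpφ s (by simpa using hs)) (abs_nonneg _) hD0
    rw [e]
    exact (abs_add_le _ _).trans (by linarith)
  · intro y hy
    have hsub : ∀ q : E → ℝ, (∀ x, Integrable fun s => g (x - s) * q s) →
        Integrable fun s => g (x - s) * q s - g (y - s) * q s := fun q h => (h x).sub (h y)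
    -- Near `K` the cut-off has the Lipschitz constant `L`, which is all that the convolution with
    -- `φ` sees; the larger constant `L'` only enters through the small factor `p - φ`.
    have e : (∫ s, g (x - s) * p s) - ∫ s, g (y - s) * p s
        = (∫ s, (g (x - s) * φ s - g (y - s) * φ s))
          - ∫ s, ((g (x - s) * φ s - g (y - s) * φ s)
            - (g (x - s) * p s - g (y - s) * p s)) := by
      rw [integral_sub (hsub _ hgφ) (hsub _ hgp), integral_sub (hgφ x) (hgφ y),
        integral_sub (hgp x) (hgp y), sub_sub_cancel]
    have h1 : |∫ s, (g (x - s) * φ s - g (y - s) * φ s)| ≤ L * ‖x - y‖ := by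
      have : ‖∫ s, (g (x - s) * φ s - g (y - s) * φ s)‖ ≤ ∫ s, L * ‖x - y‖ * φ s := by
        refine norm_integral_le_of_norm_le (hφi.const_mul _) (.of_forall fun s => ?_)
        by_cases hs : φ s = 0
        · simp [hs]
        rw [hloc x hx s hs, hloc y hy s hs, ← sub_mul, norm_mul, Real.norm_of_nonneg (hφ0 s)]
        refine mul_le_mul_of_nonneg_right ((hL (x - s) (y - s)).trans_eq ?_) (hφ0 s)
        rw [sub_sub_sub_cancel_right]
      rwa [integral_const_mul, hφ1, mul_one] at this
    have h2 : |∫ s, ((g (x - s) * φ s - g (y - s) * φ s)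
        - (g (x - s) * p s - g (y - s) * p s))| ≤ L' * ‖x - y‖ * η * v := by
      refine abs_integral_le_of_le_of_eq_zero (fun s hs => ?_)
        fun s hs => by simp [hg0 x hx s hs, hg0 y hy s hs]
      rw [← sub_mul, ← sub_mul, ← mul_sub, abs_mul]
      refine mul_le_mul ((hL' _ _).trans_eq ?_) (hpφ s (by simpa using hs)) (abs_nonneg _)
        (by positivity)
      rw [sub_sub_sub_cancel_right]
    have h3 : L' * ‖x - y‖ * η * v ≤ ε * ‖x - y‖ := by
      calc _ = L' * η * v * ‖x - y‖ := by ring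
        _ ≤ _ := by gcongr
    rw [e]
    exact (abs_sub _ _).trans (by linarith)

/-- Admissible ridge functions approximate a bounded Lipschitz function on a bounded set without
violating its bound or its Lipschitz constant: shrink an approximation that violates them only
slightly. -/
theorem exists_mem_ridgeSpan_lipschitz {ψ : ℝ → ℝ} (hψ : IsAdmissibleActivation ψ) {f : E → ℝ}
    {L : ℝ≥0} (hL : 0 < L) (hf : LipschitzWith L f) {K : Set E} (hK : Bornology.IsBounded K)
    {B : ℝ} (hB : 0 < B) (hfB : ∀ x ∈ K, |f x| ≤ B) {ε : ℝ} (hε : 0 < ε) :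
    ∃ g ∈ ridgeSpan ψ E, LipschitzOnWith L g K ∧ ∀ x ∈ K, |g x| ≤ B ∧ |f x - g x| ≤ ε := by
  have hL0 : (0 : ℝ) < L := hL
  obtain ⟨m, hm, hmL, hmB⟩ : ∃ m > 0, m ≤ (L : ℝ) ∧ m ≤ B :=
    ⟨min L B, by positivity, min_le_left _ _, min_le_right _ _⟩
  obtain ⟨δ, hδ, hδε⟩ : ∃ δ > 0, 2 * B * δ ≤ ε := ⟨ε / (2 * B), by positivity, by field_simp; rfl⟩
  obtain ⟨e, he, He⟩ := exists_mem_expSpan_lipschitz hf hK (ε := m * δ / 2) (by positivity)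
  have hexp : expSpan E ≤ lipschitzClosure (ridgeSpan ψ E) K := by
    refine Submodule.span_le.2 ?_
    rintro _ ⟨A, rfl⟩
    exact exp_inner_mem_lipschitzClosure hψ hK A
  obtain ⟨g, hg, Hg⟩ := hexp he (m * δ / 2) (by positivity)
  have hfg : ∀ x ∈ K, |f x - g x| ≤ m * δ := fun x hx => by
    have := abs_sub_le (f x) (e x) (g x)
    linarith [(He x hx).1, (Hg x hx).1]
  -- As `m ≤ B` and `m ≤ L`, both constraints are exceeded by a factor of at most `1 + δ`.
  have hgB : ∀ x ∈ K, |g x| ≤ B * (1 + δ) := fun x hx => by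
    have h1 := abs_sub_abs_le_abs_sub (g x) (f x)
    rw [abs_sub_comm] at h1
    nlinarith [hfg x hx, hfB x hx]
  have hgL : ∀ x ∈ K, ∀ y ∈ K, |g x - g y| ≤ L * (1 + δ) * ‖x - y‖ := fun x hx y hy => by
    have h1 := abs_sub (e x - e y) ((e x - g x) - (e y - g y))
    rw [show e x - e y - ((e x - g x) - (e y - g y)) = g x - g y by ring] at h1
    have h2 := (He x hx).2 y hy
    have h3 := (Hg x hx).2 y hy
    calc |g x - g y| ≤ (L + m * δ / 2) * ‖x - y‖ + m * δ / 2 * ‖x - y‖ := by linarith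
      _ = (L + m * δ) * ‖x - y‖ := by ring
      _ ≤ L * (1 + δ) * ‖x - y‖ := by
        gcongr
        nlinarith
  have h1δ : 0 < 1 + δ := by linarith
  refine ⟨(1 + δ)⁻¹ • g, Submodule.smul_mem _ _ hg, LipschitzOnWith.of_dist_le_mul ?_,
    fun x hx => ⟨?_, ?_⟩⟩
  · intro x hx y hy
    rw [Pi.smul_apply, Pi.smul_apply, smul_eq_mul, smul_eq_mul, Real.dist_eq, ← mul_sub, abs_mul,
      abs_of_pos (inv_pos.2 h1δ), inv_mul_le_iff₀ h1δ, dist_eq_norm]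
    exact (hgL x hx y hy).trans_eq (by ring)
  · rw [Pi.smul_apply, smul_eq_mul, abs_mul, abs_of_pos (inv_pos.2 h1δ), inv_mul_le_iff₀ h1δ]
    exact (hgB x hx).trans_eq (by ring)
  · have h1 : |g x - (1 + δ)⁻¹ * g x| ≤ B * δ := by
      rw [show g x - (1 + δ)⁻¹ * g x = (1 + δ)⁻¹ * δ * g x by field_simp; ring, abs_mul,
        abs_of_pos (by positivity), mul_assoc, inv_mul_le_iff₀ h1δ]
      nlinarith [hgB x hx]
    have h2 := abs_sub_le (f x) (g x) ((1 + δ)⁻¹ * g x)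
    have h3 : m * δ ≤ B * δ := by gcongr
    rw [Pi.smul_apply, smul_eq_mul]
    linarith [hfg x hx]

end ExpSpan

/-! ### Ridgelet networks with vector-valued weights -/

section Ridge

variable {ψ : ℝ → ℝ} {ι : Type} [Fintype ι] {d : ℕ}

theorem zero_mem_Ridge : (0 : EuclideanSpace ℝ ι → Fin d → ℝ) ∈ Ridge ψ ι d :=
  ⟨0, Fin.elim0, Fin.elim0, Fin.elim0, fun x => by simp⟩

theorem add_mem_Ridge {f g : EuclideanSpace ℝ ι → Fin d → ℝ} (hf : f ∈ Ridge ψ ι d)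
    (hg : g ∈ Ridge ψ ι d) : f + g ∈ Ridge ψ ι d := by
  obtain ⟨N₁, α₁, A₁, b₁, h₁⟩ := hf
  obtain ⟨N₂, α₂, A₂, b₂, h₂⟩ := hg
  refine ⟨N₁ + N₂, Fin.append α₁ α₂, Fin.append A₁ A₂, Fin.append b₁ b₂, fun x => ?_⟩
  simp [Fin.sum_univ_add, h₁, h₂]

theorem smul_const_mem_Ridge {f : EuclideanSpace ℝ ι → ℝ}
    (hf : f ∈ ridgeSpan ψ (EuclideanSpace ℝ ι)) (v : Fin d → ℝ) :
    (fun x => f x • v) ∈ Ridge ψ ι d := by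
  refine Submodule.span_induction (p := fun f _ => ∀ v : Fin d → ℝ,
    (fun x => f x • v) ∈ Ridge ψ ι d) ?_ ?_ ?_ ?_ hf v
  · rintro _ ⟨A, b, rfl⟩ v
    exact ⟨1, fun _ => v, fun _ => A, fun _ => b, fun x => by simp⟩
  · intro v
    simpa [Pi.zero_def] using zero_mem_Ridge (ψ := ψ) (ι := ι) (d := d)
  · intro f g _ _ hf hg v
    simp only [Pi.add_apply, add_smul]
    exact add_mem_Ridge (hf v) (hg v)
  · intro c f _ hf v
    simpa [smul_smul, mul_comm] using hf (c • v)

theorem mem_Ridge_of_forall_mem_ridgeSpan {g : Fin d → EuclideanSpace ℝ ι → ℝ}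
    (hg : ∀ j, g j ∈ ridgeSpan ψ (EuclideanSpace ℝ ι)) : (fun x j => g j x) ∈ Ridge ψ ι d := by
  have : (fun x j => g j x) = ∑ j, fun x => g j x • (Pi.single j 1 : Fin d → ℝ) := by
    ext x l
    simp [Finset.sum_apply, Pi.single_apply]
  rw [this]
  exact Finset.sum_induction _ (· ∈ Ridge ψ ι d) (fun _ _ => add_mem_Ridge) zero_mem_Ridge
    fun j _ => smul_const_mem_Ridge (hg j) _

end Ridge

/-! ### Continuity of the objective in the strategy -/

/-- Uniformly close bounded functions have uniformly close conditional expectations, on whose range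
the penalty is uniformly continuous. -/
theorem exists_pos_abs_integral_condExp_sub_le {α : Type*} {m₀ : MeasurableSpace α}
    {β : ℝ → ℝ}
    (hβ : Continuous β) (R : ℝ) {ε : ℝ} (hε : 0 < ε) : ∃ δ > 0, ∀ (μ : Measure α)
      [IsProbabilityMeasure μ] (m : MeasurableSpace α) (f g : α → ℝ), Integrable f μ →
      Integrable g μ → (∀ x, |f x| ≤ R) → (∀ x, |g x| ≤ R) → (∀ x, |f x - g x| ≤ δ) →
      |∫ x, β ((μ[f | m]) x) ∂μ - ∫ x, β ((μ[g | m]) x) ∂μ| ≤ ε := by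
  have hcomp : IsCompact (Set.Icc (-R) R) := isCompact_Icc
  obtain ⟨δ, hδ, H⟩ := Metric.uniformContinuousOn_iff_le.1
    (hcomp.uniformContinuousOn_of_continuous hβ.continuousOn) ε hε
  obtain ⟨D, hD⟩ := hcomp.exists_bound_of_continuousOn hβ.continuousOn
  refine ⟨δ, hδ, fun μ _ m f g hf hg hfR hgR hfg => ?_⟩
  have hf' := ae_bdd_abs_condExp_of_ae_bdd_abs (m := m) (μ := μ) (.of_forall hfR)
  have hg' := ae_bdd_abs_condExp_of_ae_bdd_abs (m := m) (μ := μ) (.of_forall hgR)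
  have hfg' := ae_bdd_abs_condExp_of_ae_bdd_abs (m := m) (μ := μ) (R := δ) (f := f - g)
    (.of_forall hfg)
  have hint : ∀ h : α → ℝ, (∀ᵐ x ∂μ, |(μ[h | m]) x| ≤ R) →
      Integrable (fun x => β ((μ[h | m]) x)) μ := fun h hh =>
    Integrable.of_bound (hβ.comp_aestronglyMeasurable integrable_condExp.aestronglyMeasurable) D
      (hh.mono fun x hx => hD _ (abs_le.1 hx))
  rw [← integral_sub (hint f hf') (hint g hg')]
  have := norm_integral_le_of_norm_le_const (μ := μ) (C := ε)
    (f := fun x => β ((μ[f | m]) x) - β ((μ[g | m]) x)) (by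
      filter_upwards [hf', hg', hfg', condExp_sub hf hg m] with x h1 h2 h3 h4
      rw [h4] at h3
      exact H _ (abs_le.1 h1) _ (abs_le.1 h2) h3)
  simpa using this

theorem continuous_pastPrices {a n : ℕ} (i : Fin n) :
    Continuous (pastPrices i : History a n → History a (i : ℕ)) := by
  unfold pastPrices
  fun_prop

namespace Market

variable {a n : ℕ} (M : Market a n)

theorem isCompact_box (i : ℕ) : IsCompact (M.box i) := by
  have h : IsCompact (Set.univ.pi fun p : Fin a × Fin i => Set.Icc (M.lower p.1) (M.upper p.1)) :=
    isCompact_univ_pi fun p => isCompact_Icc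
  have h2 := h.image (PiLp.continuous_toLp 2 (fun _ : Fin a × Fin i => ℝ))
  convert h2 using 1
  ext x
  constructor
  · intro hx
    exact ⟨x.ofLp, fun p _ => hx p.1 p.2, rfl⟩
  · rintro ⟨y, hy, rfl⟩ j l
    exact hy (j, l) trivial

theorem pastPrices_mem_box {x : History a n} (hx : x ∈ M.box n) (i : Fin n) :
    pastPrices i x ∈ M.box i := fun j l => hx j (Fin.castLE i.isLt.le l)

theorem continuous_price (j : Fin a) (i : Fin (n + 1)) : Continuous fun x => M.price x j i := by
  induction i using Fin.cases with
  | zero => exact continuous_const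
  | succ l =>
    change Continuous fun x : History a n => x (j, l)
    fun_prop

/-- The net profit of holding the positions `p i j` from time `t_i` to time `t_{i+1}` along the
price path `x`, as a function of finitely many real variables. -/
def netProfit (C : TradingCosts a n) (x : History a n) (p : Fin n → Fin a → ℝ) : ℝ :=
  (∑ j, ∑ i : Fin n, p i j * (M.price x j i.succ - M.price x j i.castSucc)) -
  ∑ j, ∑ i : Fin (n + 1),
    (C.transaction i j (M.price x j i)
        (Fin.lastCases (motive := fun _ => ℝ) 0 (fun l => p l j) i -
          Fin.cases (motive := fun _ => ℝ) 0 (fun l => p l j) i) +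
      C.liquidity i j (M.price x j i)
        (Fin.lastCases (motive := fun _ => ℝ) 0 (fun l => p l j) i -
          Fin.cases (motive := fun _ => ℝ) 0 (fun l => p l j) i) +
      C.borrowing i j (M.price x j i) (Fin.lastCases (motive := fun _ => ℝ) 0 (fun l => p l j) i))

theorem wealth_eq (C : TradingCosts a n) (c : ℝ) (Δ : Strategy a n) (x : M.Path) :
    M.wealth C c Δ x = c + M.netProfit C x fun i => Δ i (pastPrices i x) :=
  add_sub_assoc _ _ _

theorem continuous_netProfit {C : TradingCosts a n} (hC : C.IsContinuous) :
    Continuous fun q : History a n × (Fin n → Fin a → ℝ) => M.netProfit C q.1 q.2 := by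
  have hprice : ∀ j i, Continuous fun q : History a n × (Fin n → Fin a → ℝ) =>
      M.price q.1 j i := fun j i => (M.continuous_price j i).comp continuous_fst
  have hafter : ∀ (j : Fin a) (i : Fin (n + 1)),
      Continuous fun q : History a n × (Fin n → Fin a → ℝ) =>
        Fin.lastCases (motive := fun _ => ℝ) 0 (fun l => q.2 l j) i := fun j i => by
    induction i using Fin.lastCases with
    | last => simp only [Fin.lastCases_last]; exact continuous_const
    | cast l => simp only [Fin.lastCases_castSucc]; fun_prop
  have hbefore : ∀ (j : Fin a) (i : Fin (n + 1)),
      Continuous fun q : History a n × (Fin n → Fin a → ℝ) =>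
        Fin.cases (motive := fun _ => ℝ) 0 (fun l => q.2 l j) i := fun j i => by
    induction i using Fin.cases with
    | zero => exact continuous_const
    | succ l => simp only [Fin.cases_succ]; fun_prop
  unfold netProfit
  refine Continuous.sub ?_ ?_
  · refine continuous_finsetSum _ fun j _ => continuous_finsetSum _ fun i _ => ?_
    have := hprice j i.succ
    have := hprice j i.castSucc
    fun_prop
  · refine continuous_finsetSum _ fun j _ => continuous_finsetSum _ fun i _ => ?_
    have htrade := (hafter j i).sub (hbefore j i)
    exact (((hC i j).1.comp ((hprice j i).prodMk htrade)).add
      ((hC i j).2.1.comp ((hprice j i).prodMk htrade))).add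
      ((hC i j).2.2.comp ((hprice j i).prodMk (hafter j i)))

theorem continuous_wealth {C : TradingCosts a n} (hC : C.IsContinuous) (c : ℝ) {Δ : Strategy a n}
    (hΔ : ∀ i j, Continuous fun h => Δ i h j) : Continuous (M.wealth C c Δ) := by
  have h : M.wealth C c Δ = fun x : M.Path =>
      c + M.netProfit C x fun i => Δ i (pastPrices i x) := funext (M.wealth_eq C c Δ)
  rw [h]
  refine continuous_const.add ((M.continuous_netProfit hC).comp
    (continuous_subtype_val.prodMk (continuous_pi fun i => continuous_pi fun j => ?_)))
  exact (hΔ i j).comp ((continuous_pastPrices i).comp continuous_subtype_val)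

/-- The paths together with the positions bounded by `B`. -/
def pathsAndPositions (B : ℝ) : Set (History a n × (Fin n → Fin a → ℝ)) :=
  M.box n ×ˢ Set.univ.pi fun _ => Set.univ.pi fun _ => Set.Icc (-B) B

theorem isCompact_pathsAndPositions (B : ℝ) : IsCompact (M.pathsAndPositions B) :=
  (M.isCompact_box n).prod
    (isCompact_univ_pi fun _ => isCompact_univ_pi fun _ => isCompact_Icc)

theorem mem_pathsAndPositions {B : ℝ} {Δ : Strategy a n}
    (hΔ : ∀ (i : Fin n) j, ∀ h ∈ M.box i, |Δ i h j| ≤ B) (x : M.Path) :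
    ((x : History a n), fun i => Δ i (pastPrices i (x : History a n))) ∈ M.pathsAndPositions B :=
  ⟨x.2, fun i _ j _ => abs_le.1 (hΔ i j _ (M.pastPrices_mem_box x.2 i))⟩

theorem exists_mem_RidgeBL {ψ : ℝ → ℝ} (hψ : IsAdmissibleActivation ψ) {B : ℝ} (hB : 0 < B)
    {L : ℝ≥0} (hL : 0 < L) {i : ℕ} {f : History a i → Fin a → ℝ}
    (hf : ∀ j, LipschitzWith L (fun h => f h j) ∧ ∀ h ∈ M.box i, |f h j| ≤ B) {ε : ℝ}
    (hε : 0 < ε) : ∃ g ∈ M.RidgeBL ψ i B L, ∀ h ∈ M.box i, ∀ j, |f h j - g h j| ≤ ε := by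
  choose g hg hgL hgB using fun j => exists_mem_ridgeSpan_lipschitz hψ hL (hf j).1
    (M.isCompact_box i).isBounded hB (hf j).2 hε
  exact ⟨fun h j => g j h, ⟨mem_Ridge_of_forall_mem_ridgeSpan hg,
    fun j => ⟨hgL j, fun h hh => (hgB j h hh).1⟩⟩, fun h hh j => (hgB j h hh).2⟩

/-- The wealth of a ridge strategy belongs to `W`: on the box the strategy agrees with its
McShane extension, which is Lipschitz on the whole space. -/
theorem wealth_mem_WRidge {ψ : ℝ → ℝ} (C : TradingCosts a n) {B : ℝ} {L : ℝ≥0} {c : ℝ}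
    (hc : |c| ≤ B) {Δ : Strategy a n} (hΔ : ∀ i : Fin n, Δ i ∈ M.RidgeBL ψ i B L) :
    (c, M.wealth C c Δ) ∈ M.WRidge ψ C B L := by
  refine ⟨⟨hc, ?_⟩, Δ, rfl, fun i hi h j => ((hΔ i).2 j).2 h fun _ l => ?_, fun i _ => hΔ i⟩
  · choose g hgL hg using fun i j => ((hΔ i).2 j).1.extend_real
    refine ⟨fun i h j => g i j h, ?_, fun i j => ⟨hgL i j, fun h hh => ?_⟩⟩
    · ext x
      simp only [wealth_eq]
      congr 2
      ext i j
      exact hg i j (M.pastPrices_mem_box x.2 i)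
    · have hle := ((hΔ i).2 j).2 h hh
      rwa [show Δ i h j = g i j h from hg i j hh] at hle
  -- At the initial time there are no past prices, so that every history lies in the box.
  · exact absurd l.isLt (by omega)

/-- Wealth depends continuously on the positions, uniformly over the compact set of paths and
bounded positions, so that replacing a strategy by a ridge strategy changes the wealth little. -/
theorem exists_mem_WRidge_near {C : TradingCosts a n} (hC : C.IsContinuous) {ψ : ℝ → ℝ}
    (hψ : IsAdmissibleActivation ψ) {B : ℝ} (hB : 0 < B) {L : ℝ≥0} (hL : 0 < L)
    {p : ℝ × (M.Path → ℝ)} (hp : p ∈ M.W C B L) {δ : ℝ} (hδ : 0 < δ) :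
    ∃ q ∈ M.WRidge ψ C B L, q.1 = p.1 ∧ ∀ x, |p.2 x - q.2 x| ≤ δ := by
  obtain ⟨hc, Δ, hw, hΔ⟩ := hp
  obtain ⟨η, hη, H⟩ := Metric.uniformContinuousOn_iff_le.1
    ((M.isCompact_pathsAndPositions B).uniformContinuousOn_of_continuous
      (M.continuous_netProfit hC).continuousOn) δ hδ
  choose Δ' hΔ' hnear using fun i : Fin n => M.exists_mem_RidgeBL hψ hB hL (hΔ i) hη
  refine ⟨_, M.wealth_mem_WRidge C hc hΔ', rfl, fun x => ?_⟩
  have hx := M.mem_pathsAndPositions (fun i j => (hΔ i j).2) x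
  have hx' := M.mem_pathsAndPositions (fun i j => ((hΔ' i).2 j).2) x
  have hdist : dist ((x : History a n), fun i => Δ i (pastPrices i (x : History a n)))
      ((x : History a n), fun i => Δ' i (pastPrices i (x : History a n))) ≤ η := by
    rw [Prod.dist_eq, dist_self]
    refine max_le hη.le ((dist_pi_le_iff hη.le).2 fun i => (dist_pi_le_iff hη.le).2 fun j => ?_)
    exact hnear i _ (M.pastPrices_mem_box x.2 i) j
  have h := H _ hx _ hx' hdist
  simp only [hw, wealth_eq, add_sub_add_left_eq_sub]
  rwa [Real.dist_eq] at h

/-- The elements of `W` are measurable and uniformly bounded functions. -/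
theorem exists_bound_of_mem_W {C : TradingCosts a n} (hC : C.IsContinuous) (B : ℝ) (L : ℝ≥0) :
    ∃ R : ℝ, ∀ p ∈ M.W C B L, Measurable p.2 ∧ ∀ x, |p.2 x| ≤ R := by
  obtain ⟨D, hD⟩ := (M.isCompact_pathsAndPositions B).exists_bound_of_continuousOn
    (M.continuous_netProfit hC).continuousOn
  refine ⟨B + D, ?_⟩
  rintro ⟨c, w⟩ ⟨hc, Δ, hw, hΔ⟩
  dsimp only at hw hc ⊢
  subst hw
  refine ⟨(M.continuous_wealth hC c fun i j => (hΔ i j).1.continuous).measurable, fun x => ?_⟩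
  rw [wealth_eq]
  exact (abs_add_le _ _).trans
    (add_le_add hc (hD _ (M.mem_pathsAndPositions (fun i j => (hΔ i j).2) x)))

/-- The objective is continuous on `W` for uniform convergence of the wealth at equal cash. -/
theorem exists_pos_abs_objective_sub_le {C : TradingCosts a n} (hC : C.IsContinuous)
    {𝓟 : Finset (Measure M.Path)} (h𝓟 : ∀ P ∈ 𝓟, IsProbabilityMeasure P) {β : ℝ → ℝ}
    (hβ : Continuous β) (B : ℝ) (L : ℝ≥0) {Φ : M.Path → ℝ} (hΦ : Measurable Φ)
    (hΦB : ∀ x, |Φ x| ≤ B) (𝓖 : MeasurableSpace M.Path) (k : ℕ) {ε : ℝ} (hε : 0 < ε) :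
    ∃ δ > 0, ∀ p ∈ M.W C B L, ∀ q ∈ M.W C B L, q.1 = p.1 → (∀ x, |p.2 x - q.2 x| ≤ δ) →
      |M.objective 𝓟 β Φ k 𝓖 p - M.objective 𝓟 β Φ k 𝓖 q| ≤ ε := by
  obtain ⟨R, hR⟩ := M.exists_bound_of_mem_W hC B L
  obtain ⟨η, hη, hηε⟩ : ∃ η > 0, k * (𝓟.card * η) ≤ ε := by
    refine ⟨ε / (k * 𝓟.card + 1), by positivity, ?_⟩
    rw [← mul_assoc, mul_div_assoc', div_le_iff₀ (by positivity)]
    linarith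
  obtain ⟨δ, hδ, H⟩ := exists_pos_abs_integral_condExp_sub_le (α := M.Path)
    (m₀ := Subtype.instMeasurableSpace)
    hβ (B + R) hη
  refine ⟨δ, hδ, fun p hp q hq hc hpq => ?_⟩
  have hbound : ∀ p ∈ M.W C B L, ∀ x, |Φ x - p.2 x| ≤ B + R := fun p hp x =>
    (abs_sub _ _).trans (add_le_add (hΦB x) ((hR p hp).2 x))
  have hint : ∀ p ∈ M.W C B L, ∀ P ∈ 𝓟, Integrable (fun x => Φ x - p.2 x) P := fun p hp P hP => by
    have := h𝓟 P hP
    exact Integrable.of_bound (hΦ.sub (hR p hp).1).aestronglyMeasurable _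
      (.of_forall (hbound p hp))
  rw [objective, objective, hc, add_sub_add_left_eq_sub, ← mul_sub, ← Finset.sum_sub_distrib,
    abs_mul, Nat.abs_cast]
  refine le_trans (mul_le_mul_of_nonneg_left ?_ k.cast_nonneg) hηε
  refine (Finset.abs_sum_le_sum_abs _ _).trans ((Finset.sum_le_card_nsmul _ _ η ?_).trans_eq
    (nsmul_eq_mul _ _))
  intro P hP
  have := h𝓟 P hP
  refine H P 𝓖 _ _ (hint p hp P hP) (hint q hq P hP) (hbound p hp) (hbound q hq) fun x => ?_
  rw [sub_sub_sub_cancel_left, abs_sub_comm]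
  exact hpq x

end Market

theorem proposition2 {a n : ℕ} (M : Market a n)
    (C : TradingCosts a n) (hC : C.IsContinuous)
    (𝓟 : Finset (Measure M.Path)) (h𝓟 : ∀ P ∈ 𝓟, IsProbabilityMeasure P)
    (β : ℝ → ℝ) (hβ : IsPenalty β)
    (ψ : ℝ → ℝ) (hψ : IsAdmissibleActivation ψ)
    (B : ℝ) (hB : 0 < B) (L : ℝ≥0) (hL : 0 < L)
    (Φ : M.Path → ℝ) (hΦ : Measurable Φ) (hΦB : ∀ x, |Φ x| ≤ B)
    (𝓖 : MeasurableSpace M.Path) (h𝓖 : 𝓖 ≤ M.sigmaS) (k : ℕ) :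
    M.XRidge ψ C 𝓟 β B L k Φ 𝓖 = M.X C 𝓟 β B L k Φ 𝓖 := by
  refine le_antisymm (le_iInf₂ fun p hp => ?_) (biInf_mono fun p hp => hp.1)
  refine EReal.le_of_forall_lt_iff_le.1 fun z hz => ?_
  rw [EReal.coe_lt_coe_iff] at hz
  obtain ⟨δ, hδ, H⟩ := M.exists_pos_abs_objective_sub_le hC h𝓟 hβ.1 B L hΦ hΦB 𝓖 k
    (sub_pos.2 hz)
  obtain ⟨q, hq, hqc, hqp⟩ := M.exists_mem_WRidge_near hC hψ hB hL hp hδ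
  have h := (abs_le.1 (H p hp q hq.1 hqc hqp)).1
  exact (iInf₂_le q hq).trans (EReal.coe_le_coe_iff.2 (by linarith))
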